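/- **Model.** In the deterministic No-CD model there is an ID space $[N]=\{0,\dots,N-1\}$, where $N$ is known to all devices, and an unknown set $S\subseteq[N]$ of $n=|S|$ active devices, with $n\ge 2$. Time is divided into slots. In each slot every active device transmits a message (of unbounded size), listens, or stays idle. If exactly one device transmits, all listeners receive its message; if no device or at least two devices transmit, all listeners receive the same signal "silence". Transmitting and idle devices receive no signal. The action of a device in a slot is determined by $N$, its own ID and the signals it has received so far; local computation is free. The energy of a device is the number of slots in which it transmits or listens; the energy cost of an execution is the maximum energy of an active device, and its time is its number of slots. *Leader Election* is solved if exactly one active device designates itself the leader, all others designate themselves followers, and in the last slot the leader transmits a message while every follower listens. *Census* is solved if in the last slot some active device announces a list of the IDs of all active devices (all other active devices listening). Let $A(i,j)$ be the Ackermann function, given by $A(0,j)=j+1$, $A(i+1,0)=A(i,1)$, $A(i+1,j+1)=A(i,A(i+1,j))$, and let $\alpha(N)=\min\{i : A(i,i)\ge N\}$ be its inverse. **Theorem.** For every constant $c>0$ there are a deterministic No-CD algorithm and a constant $C$, both depending only on $c$, such that for all $N$ and all sets $S\subseteq[N]$ of active devices with $|S|\ge 2$ and $|S|\ge cN$, the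 algorithm solves both Leader Election and Census, with energy cost at most $C\,\alpha(N)$ and time at most $C\,N$. Moreover, define $a_0(j)=j^5$, $b_0(j)=2^j$ and, for $i\ge 1$, $$a_i(j)=a_{i-1}^{(j)}(j^4),\qquad b_i(j)=2^j\prod_{r=1}^{j} b_{i-1}\!\left(a_{i-1}^{(r-1)}(j^4)\right),$$ where $f^{(r)}$ is the $r$-fold iterate of $f$. Then $a_i(j)\ge A(i,j)$ and $b_i(j)\ge A(i,j)$ for all $i\ge 0$ and $j>32$. -/

import Mathlib

open Finset

namespace NoCD

/-- Messages are finite lists of natural numbers: their size is unbounded, and any finite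
amount of information can be encoded in one message. -/
abbrev Message := List ℕ

/-- What a device does in one time slot. -/
inductive SlotAction where
  | transmit (m : Message)
  | listen
  | idle

/-- What a device perceives in one time slot. Only listeners receive a signal; `nothing` is the
empty perception of transmitting and of idle devices. -/
inductive Perception where
  | nothing
  | silence
  | heard (m : Message)

/-- The final designation of a device. -/
inductive Role where
  | leader
  | follower

namespace SlotAction

/-- The message that is put on the channel, if any. -/
def sent : SlotAction → Option Message
  | transmit m => some m
  | listen => none
  | idle => none

/-- Transmitting and listening cost one unit of energy, idling is free. -/
def cost : SlotAction → ℕ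
  | transmit _ => 1
  | listen => 1
  | idle => 0

end SlotAction

/-- A deterministic algorithm. `time N` is the number of time slots used on ID space
`{0, …, N - 1}`. A device knows `N`, its own ID, and the list of its own past perceptions (most
recent first); these determine its next action and, after the last slot, its role. (The past
actions of the device are determined by the same data. Local computation is free.) -/
structure Algorithm where
  time : ℕ → ℕ
  act : (N : ℕ) → Fin N → List Perception → SlotAction
  role : (N : ℕ) → Fin N → List Perception → Role

/-- The state of the channel when the set of active devices is `S` and device `v` performs `a v`:
a message if exactly one active device transmits, and `none` if no device or at least two devices
transmit (these two cases cannot be distinguished). -/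
def channel {N : ℕ} (S : Finset (Fin N)) (a : Fin N → SlotAction) : Option Message :=
  match (S.sort (· ≤ ·)).filterMap (fun v => (a v).sent) with
  | [m] => some m
  | _ => none

/-- The perception of a device in the No-CD model, from its own action and the channel. -/
def perceive : SlotAction → Option Message → Perception
  | SlotAction.transmit _, _ => Perception.nothing
  | SlotAction.idle, _ => Perception.nothing
  | SlotAction.listen, none => Perception.silence
  | SlotAction.listen, some m => Perception.heard m

namespace Algorithm

variable (A : Algorithm) {N : ℕ} (S : Finset (Fin N))

/-- The perceptions of each device during the first `t` slots of the execution of `A` in which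
the set of active devices is `S`. -/
def history : ℕ → Fin N → List Perception
  | 0 => fun _ => []
  | t + 1 => fun v =>
      perceive (A.act N v (history t v)) (channel S (fun w => A.act N w (history t w)))
        :: history t v

/-- The action of device `v` in slot `t` (slots are numbered from `0`). -/
def action (t : ℕ) (v : Fin N) : SlotAction :=
  A.act N v (A.history S t v)

/-- The designation of device `v` at the end of the execution. -/
def finalRole (v : Fin N) : Role :=
  A.role N v (A.history S (A.time N) v)

/-- The energy spent by device `v`: the number of slots in which it transmits or listens. -/
def energy (v : Fin N) : ℕ :=
  ∑ t ∈ range (A.time N), (A.action S t v).cost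

/-- In slot `t` device `v` transmits the message `m` and every other active device listens. -/
def Announces (t : ℕ) (v : Fin N) (m : Message) : Prop :=
  A.action S t v = SlotAction.transmit m ∧ ∀ w ∈ S, w ≠ v → A.action S t w = SlotAction.listen

/-- Leader Election: exactly one active device designates itself the leader, all others designate
themselves followers, and in the last slot of the computation the leader transmits a message
while every follower listens. -/
def SolvesLeaderElection : Prop :=
  ∃ v ∈ S, A.finalRole S v = Role.leader ∧
    (∀ w ∈ S, w ≠ v → A.finalRole S w = Role.follower) ∧
    ∃ t m, A.time N = t + 1 ∧ A.Announces S t v m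

/-- Census: in the last slot of the computation some active device announces a list of the IDs of
all active devices. -/
def SolvesCensus : Prop :=
  ∃ v ∈ S, ∃ t m, A.time N = t + 1 ∧ A.Announces S t v m ∧
    m.Nodup ∧ ∀ x : ℕ, x ∈ m ↔ ∃ w ∈ S, (w : ℕ) = x

end Algorithm

/-- The inverse Ackermann function: the least `i` with `N ≤ ack i i`. -/
def inverseAck (N : ℕ) : ℕ :=
  Nat.find (p := fun i => N ≤ ack i i) ⟨N, (lt_ack_left N N).le⟩

/-- The growth function `a_i(j)`: `a_0(j) = j ^ 5`, and `a_{i+1}(j)` is the `j`-fold iterate of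
`a_i` applied to `j ^ 4`. -/
def growthA : ℕ → ℕ → ℕ
  | 0, j => j ^ 5
  | i + 1, j => (growthA i)^[j] (j ^ 4)

/-- The growth function `b_i(j)`: `b_0(j) = 2 ^ j`, and `b_{i+1}(j)` is `2 ^ j` times the product
of `b_i` over the first `j` terms of the `a_i`-orbit of `j ^ 4`. -/
def growthB : ℕ → ℕ → ℕ
  | 0, j => 2 ^ j
  | i + 1, j => 2 ^ j * ∏ r ∈ range j, growthB i ((growthA i)^[r] (j ^ 4))

end NoCD

/-!
The ID space is cut into aligned blocks of length `2 ^ l`, which are merged level by level: the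
devices of a block share its roster, one of them reports it, and the devices that are awake at the
next level hear the rosters of both halves of their new block. A block of level `l` with fewer than
`2 ^ (l / 2)` devices is given up. There are only `2 ^ (top - l)` blocks of level `l`, so these
losses form a geometric series, and if blocks below a suitable constant level are kept, at least
half of the devices of a dense set survive up to the single block of the top level.

Energy is saved by keeping only a small team of each block awake at each level. As every surviving
block is thick, its devices can be dealt by rank into `2 ^ t` teams, all of which are still present
in every block of the higher levels; a device that sleeps can tell from its latest roster which team
it belongs to. A phase of order `0` lets the teams work for one level each. A phase of order
`i + 1` lets each team in turn run a phase of order `i`, which costs every device only a constant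
number of additional levels, while the length of the phases grows with the order like the rows of
the Ackermann function. So a phase of order `inverseAck N + 1` covers all levels.

In the end the survivors share one roster. Each of them listens to a constant number of IDs of given
up devices, and the collected lists are passed along the survivors in order of rank. The last of
them is the leader and announces the list of all devices.
-/

namespace NoCD

/-! ### The growth functions -/

lemma ack_succ_eq_iterate (m n : ℕ) : ack (m + 1) n = (ack m)^[n + 1] 1 := by
  induction n with
  | zero => simp
  | succ n ih => rw [ack_succ_succ, ih, ← Function.iterate_succ_apply' (ack m)]

lemma iterate_ack_pos (m r : ℕ) : 0 < (ack m)^[r] 1 := by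
  cases r with
  | zero => exact one_pos
  | succ r => rw [Function.iterate_succ_apply']; exact ack_pos m _

lemma iterate_ack_lt_iterate {f : ℕ → ℕ} {m : ℕ} (hf : ∀ x, 1 < x → ack m (x - 1) < f x)
    {y : ℕ} (hy : 1 < y) (r : ℕ) : (ack m)^[r] 1 < f^[r] y := by
  induction r with
  | zero => exact hy
  | succ r ih =>
    rw [Function.iterate_succ_apply', Function.iterate_succ_apply']
    exact (ack_le_ack le_rfl (Nat.le_sub_one_of_lt ih)).trans_lt
      (hf _ ((Nat.succ_le_of_lt (iterate_ack_pos m r)).trans_lt ih))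

lemma one_lt_pow_four {j : ℕ} (hj : 1 < j) : 1 < j ^ 4 :=
  Nat.one_lt_pow (by norm_num) hj

lemma ack_succ_pred_lt_growthA (i : ℕ) {j : ℕ} (hj : 1 < j) :
    ack (i + 1) (j - 1) < growthA i j := by
  induction i generalizing j with
  | zero =>
    calc ack 1 (j - 1) < j * 2 := by rw [ack_one]; omega
      _ ≤ j * j ^ 4 := Nat.mul_le_mul_left _ (one_lt_pow_four hj)
      _ = j ^ 5 := by ring
  | succ i ih =>
    rw [ack_succ_eq_iterate, Nat.sub_add_cancel hj.le]
    exact iterate_ack_lt_iterate (fun _ => ih) (one_lt_pow_four hj) j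

lemma growthB_pos (i j : ℕ) : 0 < growthB i j := by
  induction i generalizing j with
  | zero => exact Nat.two_pow_pos j
  | succ i ih => exact Nat.mul_pos (Nat.two_pow_pos j) (prod_pos fun _ _ => ih _)

lemma ack_succ_pred_le_growthB (i : ℕ) {j : ℕ} (hj : 1 < j) :
    ack (i + 1) (j - 1) ≤ growthB i j := by
  induction i generalizing j with
  | zero =>
    have := Nat.lt_two_pow_self (n := j)
    simp only [growthB, zero_add, ack_one]
    omega
  | succ i ih =>
    obtain ⟨k, rfl⟩ : ∃ k, j = k + 1 := ⟨j - 1, by omega⟩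
    set x := (growthA i)^[k] ((k + 1) ^ 4)
    have iterate_lt : (ack (i + 1))^[k] 1 < x :=
      iterate_ack_lt_iterate (fun _ => ack_succ_pred_lt_growthA i) (one_lt_pow_four hj) k
    have one_lt : 1 < x := (Nat.succ_le_of_lt (iterate_ack_pos _ _)).trans_lt iterate_lt
    calc ack (i + 1 + 1) (k + 1 - 1)
        = ack (i + 1) ((ack (i + 1))^[k] 1) := by
          rw [ack_succ_eq_iterate, Nat.add_sub_cancel, Function.iterate_succ_apply']
      _ ≤ ack (i + 1) (x - 1) := ack_le_ack le_rfl (Nat.le_sub_one_of_lt iterate_lt)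
      _ ≤ growthB i x := ih one_lt
      _ ≤ ∏ r ∈ range (k + 1), growthB i ((growthA i)^[r] ((k + 1) ^ 4)) :=
          single_le_prod' (f := fun r => growthB i ((growthA i)^[r] ((k + 1) ^ 4)))
            (fun r _ => growthB_pos i _) (self_mem_range_succ k)
      _ ≤ growthB (i + 1) (k + 1) := Nat.le_mul_of_pos_left _ (Nat.two_pow_pos _)

lemma ack_le_ack_succ_pred (i : ℕ) {j : ℕ} (hj : 1 < j) : ack i j ≤ ack (i + 1) (j - 1) := by
  obtain ⟨k, rfl⟩ : ∃ k, j = k + 1 := ⟨j - 1, by omega⟩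
  exact ack_succ_right_le_ack_succ_left i k

lemma ack_le_growthA (i : ℕ) {j : ℕ} (hj : 1 < j) : ack i j ≤ growthA i j :=
  (ack_le_ack_succ_pred i hj).trans (ack_succ_pred_lt_growthA i hj).le

lemma ack_le_growthB (i : ℕ) {j : ℕ} (hj : 1 < j) : ack i j ≤ growthB i j :=
  (ack_le_ack_succ_pred i hj).trans (ack_succ_pred_le_growthB i hj)

/-! ### Aligned blocks of IDs and their division into teams -/

/-- The members of `X` in the same aligned block of length `2 ^ l` as `v`. Such a block is the
analogue of a subtree of height `l` in the binary tree over the ID space. -/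
def block (l v : ℕ) (X : Finset ℕ) : Finset ℕ :=
  {w ∈ X | w / 2 ^ l = v / 2 ^ l}

lemma mem_block {l v w : ℕ} {X : Finset ℕ} :
    w ∈ block l v X ↔ w ∈ X ∧ w / 2 ^ l = v / 2 ^ l :=
  mem_filter

lemma mem_block_self {l v : ℕ} {X : Finset ℕ} : v ∈ block l v X ↔ v ∈ X := by
  simp [mem_block]

lemma div_two_pow_congr_of_le {k l v w : ℕ} (hkl : k ≤ l) (hwv : w / 2 ^ k = v / 2 ^ k) :
    w / 2 ^ l = v / 2 ^ l := by
  obtain ⟨d, rfl⟩ := Nat.exists_eq_add_of_le hkl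
  rw [pow_add, ← Nat.div_div_eq_div_mul, ← Nat.div_div_eq_div_mul, hwv]

lemma block_congr {l v w : ℕ} (hwv : w / 2 ^ l = v / 2 ^ l) (X : Finset ℕ) :
    block l w X = block l v X := by
  simp only [block, hwv]

lemma block_block {k l : ℕ} (hkl : k ≤ l) (v : ℕ) (X : Finset ℕ) :
    block k v (block l v X) = block k v X := by
  ext w
  simp only [mem_block]
  exact ⟨fun hw => ⟨hw.1.1, hw.2⟩, fun hw => ⟨⟨hw.1, div_two_pow_congr_of_le hkl hw.2⟩, hw.2⟩⟩

lemma block_eq_block_of_le {k l v : ℕ} {X Y : Finset ℕ} (hkl : k ≤ l)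
    (hXY : block l v X = block l v Y) : block k v X = block k v Y := by
  rw [← block_block hkl v X, hXY, block_block hkl]

/-- The number of elements of `P` that precede `v`. -/
def rank (P : Finset ℕ) (v : ℕ) : ℕ :=
  Nat.count (· ∈ P) v

lemma rank_injOn (P : Finset ℕ) : Set.InjOn (rank P) P :=
  fun _ hv _ hw => Nat.count_injective hv hw

lemma rank_lt_card {P : Finset ℕ} {v : ℕ} (hv : v ∈ P) : rank P v < #P := by
  rw [rank]
  simpa using Nat.count_lt_card (p := (· ∈ P)) P.finite_toSet hv

lemma exists_rank_eq {P : Finset ℕ} {r : ℕ} (hr : r < #P) : ∃ v ∈ P, rank P v = r := by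
  have hr' : r < #(Set.Finite.toFinset (s := Set.ofPred (· ∈ P)) P.finite_toSet) := by simpa
  exact ⟨_, Nat.nth_mem_of_lt_card P.finite_toSet hr',
    Nat.count_nth_of_lt_card_finite P.finite_toSet hr'⟩

lemma div_le_card_filter_rank_mod (P : Finset ℕ) {T r : ℕ} (hr : r < T) :
    #P / T ≤ #{v ∈ P | rank P v % T = r} := by
  have exists_rank : ∀ j ∈ range (#P / T), ∃ v ∈ P, rank P v = j * T + r := by
    refine fun j hj => exists_rank_eq ?_
    calc j * T + r < (j + 1) * T := by rw [add_mul]; omega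
      _ ≤ #P / T * T := Nat.mul_le_mul_right _ (mem_range.1 hj)
      _ ≤ #P := Nat.div_mul_le_self _ _
  choose! nth nth_mem rank_nth using exists_rank
  rw [← card_range (#P / T)]
  refine card_le_card_of_injOn nth (fun j hj => mem_coe.2 (mem_filter.2 ⟨nth_mem j hj, ?_⟩)) ?_
  · rw [rank_nth j hj, Nat.mul_add_mod_self_right, Nat.mod_eq_of_lt hr]
  · intro j hj k hk hjk
    have rank_eq : j * T + r = k * T + r := by rw [← rank_nth j hj, hjk, rank_nth k hk]
    exact Nat.eq_of_mul_eq_mul_right (by omega) (Nat.add_right_cancel rank_eq)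

/-- A splitting instruction: inside every block of level `level` the devices are dealt into
`teams` teams according to their rank modulo `teams`, and team number `index` is selected. -/
structure Split where
  level : ℕ
  teams : ℕ
  index : ℕ

/-- The members of `P` that are selected by a splitting instruction. -/
def split (s : Split) (P : Finset ℕ) : Finset ℕ :=
  {v ∈ P | rank (block s.level v P) v % s.teams = s.index}

/-- The members of `P` that are selected by a list of successive splitting instructions. -/
def team (p : List Split) (P : Finset ℕ) : Finset ℕ :=
  p.foldl (fun Q s => split s Q) P

lemma split_subset (s : Split) (P : Finset ℕ) : split s P ⊆ P :=
  filter_subset _ _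

lemma team_nil (P : Finset ℕ) : team [] P = P := rfl

lemma team_cons (s : Split) (p : List Split) (P : Finset ℕ) :
    team (s :: p) P = team p (split s P) := rfl

lemma team_append (p p' : List Split) (P : Finset ℕ) :
    team (p ++ p') P = team p' (team p P) :=
  List.foldl_append

lemma team_subset (p : List Split) (P : Finset ℕ) : team p P ⊆ P := by
  induction p generalizing P with
  | nil => exact Subset.rfl
  | cons s p ih => exact (ih _).trans (split_subset s P)

lemma block_split {s : Split} {k : ℕ} (hs : s.level ≤ k) (v : ℕ) (P : Finset ℕ) :
    block k v (split s P) = split s (block k v P) := by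
  have inner_block : ∀ w, w / 2 ^ k = v / 2 ^ k →
      block s.level w (block k v P) = block s.level w P := fun w hwv => by
    rw [← block_congr hwv, block_block hs]
  ext w
  simp only [mem_block, split, mem_filter]
  constructor
  · rintro ⟨⟨hwP, hrank⟩, hwv⟩
    exact ⟨⟨hwP, hwv⟩, by rwa [inner_block w hwv]⟩
  · rintro ⟨⟨hwP, hwv⟩, hrank⟩
    exact ⟨⟨hwP, by rwa [inner_block w hwv] at hrank⟩, hwv⟩

lemma block_team {p : List Split} {k : ℕ} (hp : ∀ s ∈ p, s.level ≤ k) (v : ℕ) (P : Finset ℕ) :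
    block k v (team p P) = team p (block k v P) := by
  induction p generalizing P with
  | nil => rfl
  | cons s p ih =>
    rw [team_cons, team_cons, ih (fun s' hs' => hp s' (List.mem_cons_of_mem s hs')),
      block_split (hp s List.mem_cons_self)]

lemma mem_team_congr {p : List Split} {k v : ℕ} {X Y : Finset ℕ} (hp : ∀ s ∈ p, s.level ≤ k)
    (hXY : block k v X = block k v Y) : v ∈ team p X ↔ v ∈ team p Y := by
  rw [← mem_block_self (l := k), block_team hp, hXY, ← block_team hp, mem_block_self]

/-- `P` contains at least a `2 ^ (-q)` fraction of `X` in each block of level `b`. -/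
def BlockDense (b q : ℕ) (P X : Finset ℕ) : Prop :=
  ∀ v ∈ X, #(block b v X) ≤ 2 ^ q * #(block b v P)

lemma BlockDense.mono {b b' q : ℕ} {P X : Finset ℕ} (hdense : BlockDense b q P X)
    (hb : b ≤ b') : BlockDense b' q P X := by
  intro v _
  have fiber_eq : ∀ w ∈ block b' v X, ∀ Y : Finset ℕ,
      {u ∈ block b' v Y | u / 2 ^ b = w / 2 ^ b} = block b w Y := fun w hw Y => by
    rw [← block_congr (mem_block.1 hw).2, ← block_block hb w Y]
    rfl
  set fibers := (block b' v X).image (· / 2 ^ b)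
  calc #(block b' v X) = ∑ t ∈ fibers, #{w ∈ block b' v X | w / 2 ^ b = t} :=
        card_eq_sum_card_fiberwise fun w hw => mem_image_of_mem _ hw
    _ ≤ ∑ t ∈ fibers, 2 ^ q * #{w ∈ block b' v P | w / 2 ^ b = t} := by
        refine sum_le_sum fun t ht => ?_
        obtain ⟨w, hw, rfl⟩ := mem_image.1 ht
        rw [fiber_eq w hw, fiber_eq w hw]
        exact hdense w (mem_block.1 hw).1
    _ = 2 ^ q * ∑ t ∈ fibers, #{w ∈ block b' v P | w / 2 ^ b = t} := (mul_sum _ _ _).symm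
    _ ≤ 2 ^ q * #(block b' v P) := by
        rw [sum_card_fiberwise_eq_card_filter]
        exact Nat.mul_le_mul_left _ (card_filter_le _ _)

lemma blockDense_split {b q t r : ℕ} {P X : Finset ℕ} (hdense : BlockDense b q P X)
    (hlarge : ∀ v ∈ X, 2 ^ t ≤ #(block b v P)) (hr : r < 2 ^ t) :
    BlockDense b (q + t + 1) (split ⟨b, 2 ^ t, r⟩ P) X := by
  intro v hv
  set B := block b v P
  have block_split_eq : block b v (split ⟨b, 2 ^ t, r⟩ P) = {w ∈ B | rank B w % 2 ^ t = r} := by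
    rw [block_split (s := ⟨b, 2 ^ t, r⟩) le_rfl]
    refine filter_congr fun w hw => ?_
    rw [block_congr (mem_block.1 hw).2, block_block le_rfl]
  have div_pos : 1 ≤ #B / 2 ^ t := Nat.div_pos (hlarge v hv) (by positivity)
  have card_lt : #B < 2 ^ t * (#B / 2 ^ t + 1) := Nat.lt_mul_div_succ _ (by positivity)
  rw [block_split_eq]
  calc #(block b v X) ≤ 2 ^ q * #B := hdense v hv
    _ ≤ 2 ^ q * (2 ^ t * (2 * (#B / 2 ^ t))) := by
        gcongr
        exact card_lt.le.trans (Nat.mul_le_mul_left _ (by omega))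
    _ ≤ 2 ^ q * (2 ^ t * (2 * #{w ∈ B | rank B w % 2 ^ t = r})) := by
        gcongr
        exact div_le_card_filter_rank_mod B hr
    _ = _ := by ring

/-! ### The wake-up schedule -/

/-- The binary logarithm of the number of teams that are formed at level `b` by a `2 ^ (-q)`
fraction of the devices: if the blocks of level `b` contain `2 ^ (b / 2)` devices, then every team
has a member in every block. -/
def teamExp (b q : ℕ) : ℕ :=
  b / 2 - q

/-- The level at which the one-level shifts of the teams formed at level `b` are over. -/
def regroupLevel (b q : ℕ) : ℕ :=
  b + 2 ^ teamExp b q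

/-- The level at which the `r`-th subphase of a phase of positive order starts, where `f c p` is
the last level of a subphase that starts at level `c` with a `2 ^ (-p)` fraction of the devices. -/
def subphaseStart (f : ℕ → ℕ → ℕ) (b q r : ℕ) : ℕ :=
  (fun c => f c (q + teamExp b q + 1))^[r] (regroupLevel b q + 1)

/-- The level at which a phase of order `i` ends, if it starts at level `b` with a
`2 ^ (-q)` fraction of the devices. A phase of order `0` deals the devices into teams and wakes one
team per level. A phase of order `i + 1` performs a phase of order `0`, wakes everybody once, deals
the devices into teams, and lets these perform phases of order `i` one after the other. -/
def finish : ℕ → ℕ → ℕ → ℕ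
  | 0, b, q => regroupLevel b q
  | i + 1, b, q => subphaseStart (finish i) b q (2 ^ teamExp b q)

/-- The splitting instructions that select the devices that are awake at level `l`, during a phase
of order `0` that starts at level `b` with a `2 ^ (-q)` fraction of the devices. -/
def baseRoute (b q l : ℕ) : List Split :=
  if l = b then [] else [⟨b, 2 ^ teamExp b q, l - b⟩]

/-- The splitting instructions that select the devices that are awake at level `l`, during a phase
of order `i` that starts at level `b` with a `2 ^ (-q)` fraction of the devices. -/
def route : ℕ → ℕ → ℕ → ℕ → List Split
  | 0, b, q, l => baseRoute b q l
  | i + 1, b, q, l =>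
    if l < regroupLevel b q then baseRoute b q l
    else if l = regroupLevel b q then []
    else
      let r := Nat.findGreatest (fun r => subphaseStart (finish i) b q r ≤ l) (2 ^ teamExp b q)
      ⟨regroupLevel b q, 2 ^ teamExp b q, r⟩ ::
        route i (subphaseStart (finish i) b q r) (q + teamExp b q + 1) l

lemma lt_regroupLevel (b q : ℕ) : b < regroupLevel b q :=
  Nat.lt_add_of_pos_right (Nat.two_pow_pos _)

lemma subphaseStart_succ (f : ℕ → ℕ → ℕ) (b q r : ℕ) :
    subphaseStart f b q (r + 1) = f (subphaseStart f b q r) (q + teamExp b q + 1) :=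
  Function.iterate_succ_apply' _ r _

lemma subphaseStart_strictMono {f : ℕ → ℕ → ℕ} (hf : ∀ c p, c < f c p) (b q : ℕ) :
    StrictMono (subphaseStart f b q) :=
  strictMono_nat_of_lt_succ fun r => by rw [subphaseStart_succ]; exact hf _ _

lemma regroupLevel_lt_subphaseStart_of_lt {f : ℕ → ℕ → ℕ} (hf : ∀ c p, c < f c p) (b q r : ℕ) :
    regroupLevel b q < subphaseStart f b q r :=
  (Nat.lt_succ_self _).trans_le ((subphaseStart_strictMono hf b q).monotone r.zero_le)

lemma lt_finish (i b q : ℕ) : b < finish i b q := by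
  induction i generalizing b q with
  | zero => exact lt_regroupLevel b q
  | succ i ih => exact (lt_regroupLevel b q).trans (regroupLevel_lt_subphaseStart_of_lt ih b q _)

lemma regroupLevel_lt_subphaseStart (i b q r : ℕ) :
    regroupLevel b q < subphaseStart (finish i) b q r :=
  regroupLevel_lt_subphaseStart_of_lt (lt_finish i) b q r

lemma exists_subphase {i b q l : ℕ} (hlb : regroupLevel b q < l) (hl : l < finish (i + 1) b q) :
    ∃ r < 2 ^ teamExp b q,
      subphaseStart (finish i) b q r ≤ l ∧ l < subphaseStart (finish i) b q (r + 1) := by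
  have mono := subphaseStart_strictMono (lt_finish i) b q
  set r := Nat.findGreatest (fun r => subphaseStart (finish i) b q r ≤ l) (2 ^ teamExp b q)
  have start_le : subphaseStart (finish i) b q r ≤ l :=
    Nat.findGreatest_spec (P := fun r => subphaseStart (finish i) b q r ≤ l) (Nat.zero_le _) hlb
  have r_lt : r < 2 ^ teamExp b q := mono.lt_iff_lt.1 (start_le.trans_lt hl)
  exact ⟨r, r_lt, start_le, not_le.1
    (Nat.findGreatest_is_greatest (P := fun r => subphaseStart (finish i) b q r ≤ l)
      (Nat.lt_succ_self r) r_lt)⟩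

lemma baseRoute_self (b q : ℕ) : baseRoute b q b = [] :=
  if_pos rfl

lemma route_succ_of_lt {i b q l : ℕ} (hl : l < regroupLevel b q) :
    route (i + 1) b q l = baseRoute b q l :=
  if_pos hl

lemma route_succ_regroupLevel (i b q : ℕ) : route (i + 1) b q (regroupLevel b q) = [] := by
  simp [route]

lemma route_self (i b q : ℕ) : route i b q b = [] := by
  cases i with
  | zero => exact baseRoute_self b q
  | succ i => rw [route_succ_of_lt (lt_regroupLevel b q), baseRoute_self]

lemma route_succ_of_mem_subphase {i b q r l : ℕ} (hr : r < 2 ^ teamExp b q)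
    (hstart : subphaseStart (finish i) b q r ≤ l)
    (hend : l < subphaseStart (finish i) b q (r + 1)) :
    route (i + 1) b q l = ⟨regroupLevel b q, 2 ^ teamExp b q, r⟩ ::
      route i (subphaseStart (finish i) b q r) (q + teamExp b q + 1) l := by
  have mono := (subphaseStart_strictMono (lt_finish i) b q).monotone
  have lt_l : regroupLevel b q < l := (regroupLevel_lt_subphaseStart i b q r).trans_le hstart
  have findGreatest_eq :
      Nat.findGreatest (fun r => subphaseStart (finish i) b q r ≤ l) (2 ^ teamExp b q) = r :=
    Nat.findGreatest_eq_iff.2 ⟨hr.le, fun _ => hstart,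
      fun _ hn _ hnl => absurd (hend.trans_le (mono hn)) (not_lt.2 hnl)⟩
  rw [route, if_neg lt_l.not_gt, if_neg lt_l.ne', findGreatest_eq]

lemma baseRoute_consistent (i : ℕ) {b q l : ℕ} (hbl : b ≤ l) {p p' : List Split} {s : Split}
    (hroute : baseRoute b q l = p ++ s :: p') :
    b ≤ s.level ∧ s.level < l ∧ route i b q s.level = p := by
  unfold baseRoute at hroute
  split_ifs at hroute with hl
  · simp at hroute
  · rcases p with _ | ⟨a, p⟩
    · obtain rfl := (List.cons.inj hroute).1
      exact ⟨le_rfl, by dsimp only; omega, route_self i b q⟩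
    · simp at hroute

/-- The teams of an instruction of level `s.level` are formed by the devices that are awake at that
level, so these devices can compute the outcome. -/
lemma route_consistent (i : ℕ) {b q l : ℕ} (hbl : b ≤ l) (hl : l < finish i b q)
    {p p' : List Split} {s : Split} (hroute : route i b q l = p ++ s :: p') :
    b ≤ s.level ∧ s.level < l ∧ route i b q s.level = p := by
  induction i generalizing b q p with
  | zero => exact baseRoute_consistent 0 hbl hroute
  | succ i ih =>
    rcases lt_trichotomy l (regroupLevel b q) with hlt | rfl | hgt
    · rw [route_succ_of_lt hlt] at hroute
      exact baseRoute_consistent (i + 1) hbl hroute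
    · simp [route_succ_regroupLevel] at hroute
    · obtain ⟨r, hr, hstart, hend⟩ := exists_subphase hgt hl
      rw [route_succ_of_mem_subphase hr hstart hend] at hroute
      rcases p with _ | ⟨a, p⟩
      · obtain rfl := (List.cons.inj hroute).1
        exact ⟨(lt_regroupLevel b q).le, hgt, route_succ_regroupLevel i b q⟩
      · obtain ⟨rfl, htail⟩ := List.cons.inj hroute
        obtain ⟨start_le, hlt, heq⟩ := ih hstart (hend.trans_eq (subphaseStart_succ _ b q r)) htail
        have lt_start := regroupLevel_lt_subphaseStart i b q r
        exact ⟨((lt_regroupLevel b q).trans lt_start).le.trans start_le, hlt,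
          heq ▸ route_succ_of_mem_subphase hr start_le (hlt.trans hend)⟩

lemma card_baseRoute_le (b q : ℕ) (P : Finset ℕ) (v : ℕ) :
    #{l ∈ Ico b (regroupLevel b q) | v ∈ team (baseRoute b q l) P} ≤ 2 := by
  refine (card_le_card (t := {b, b + rank (block b v P) v % 2 ^ teamExp b q}) fun l hl => ?_).trans
    card_le_two
  obtain ⟨hl, hawake⟩ := mem_filter.1 hl
  unfold baseRoute at hawake
  split_ifs at hawake with hlb
  · exact hlb ▸ mem_insert_self _ _
  · have hrank : rank (block b v P) v % 2 ^ teamExp b q = l - b := (mem_filter.1 hawake).2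
    rw [hrank, Nat.add_sub_cancel' (mem_Ico.1 hl).1]
    exact mem_insert_of_mem (mem_singleton_self l)

lemma card_route_le (i b q : ℕ) (P : Finset ℕ) (v : ℕ) :
    #{l ∈ Ico b (finish i b q) | v ∈ team (route i b q l) P} ≤ 3 * i + 2 := by
  induction i generalizing b q P with
  | zero => exact card_baseRoute_le b q P v
  | succ i ih =>
    set c := regroupLevel b q
    set r := rank (block c v P) v % 2 ^ teamExp b q
    set g := subphaseStart (finish i) b q r
    set q' := q + teamExp b q + 1
    have awake_subset : {l ∈ Ico b (finish (i + 1) b q) | v ∈ team (route (i + 1) b q l) P} ⊆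
        {l ∈ Ico b c | v ∈ team (baseRoute b q l) P} ∪ ({c} ∪
          {l ∈ Ico g (finish i g q') | v ∈ team (route i g q' l) (split ⟨c, 2 ^ teamExp b q, r⟩ P)})
        := by
      intro l hl
      simp only [mem_filter, mem_Ico] at hl
      obtain ⟨⟨hbl, hlt⟩, hawake⟩ := hl
      simp only [mem_union, mem_singleton, mem_filter, mem_Ico]
      rcases lt_trichotomy l c with hlc | hlc | hlc
      · exact Or.inl ⟨⟨hbl, hlc⟩, route_succ_of_lt hlc ▸ hawake⟩
      · exact Or.inr (Or.inl hlc)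
      · obtain ⟨r', hr', hstart, hend⟩ := exists_subphase hlc hlt
        rw [route_succ_of_mem_subphase hr' hstart hend, team_cons] at hawake
        obtain rfl : r = r' := (mem_filter.1 (team_subset _ _ hawake)).2
        exact Or.inr (Or.inr ⟨⟨hstart, hend.trans_eq (subphaseStart_succ _ b q r)⟩, hawake⟩)
    calc _ ≤ 2 + (1 + (3 * i + 2)) := (card_le_card awake_subset).trans <|
          (card_union_le _ _).trans <| add_le_add (card_baseRoute_le b q P v) <|
          (card_union_le _ _).trans <| add_le_add (card_singleton c).le (ih g q' _)
      _ = 3 * (i + 1) + 2 := by ring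

/-- Every nonempty block of a level `k` between `b₀` and `L` contains at least `2 ^ (k / 2)`
devices. -/
def Thick (b₀ L : ℕ) (X : Finset ℕ) : Prop :=
  ∀ k, b₀ ≤ k → k ≤ L → ∀ v ∈ X, 2 ^ (k / 2) ≤ #(block k v X)

section Thick

variable {b₀ b q l L v : ℕ} {P X : Finset ℕ}

lemma Thick.two_pow_teamExp_le (hX : Thick b₀ L X) (hdense : BlockDense b q P X) (hb : b₀ ≤ b)
    (hL : b ≤ L) (hv : v ∈ X) : 2 ^ teamExp b q ≤ #(block b v P) := by
  have two_pow_le : 2 ^ (b / 2) ≤ 2 ^ q * #(block b v P) := (hX b hb hL v hv).trans (hdense v hv)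
  rcases le_total q (b / 2) with hq | hq
  · rw [← Nat.add_sub_cancel' hq, pow_add] at two_pow_le
    exact Nat.le_of_mul_le_mul_left two_pow_le (Nat.two_pow_pos q)
  · rw [teamExp, Nat.sub_eq_zero_of_le hq, pow_zero]
    exact Nat.pos_of_mul_pos_left ((Nat.two_pow_pos _).trans_le two_pow_le)

lemma Thick.exists_mem (hX : Thick b₀ L X) (hdense : BlockDense b q P X) (hb : b₀ ≤ b)
    (hbl : b ≤ l) (hL : b ≤ L) (hv : v ∈ X) : ∃ w ∈ P, w / 2 ^ l = v / 2 ^ l := by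
  obtain ⟨w, hw⟩ := card_pos.1 <|
    (Nat.two_pow_pos _).trans_le (hX.two_pow_teamExp_le hdense hb hL hv)
  exact ⟨w, (mem_block.1 hw).1, div_two_pow_congr_of_le hbl (mem_block.1 hw).2⟩

lemma Thick.exists_awake_base (hX : Thick b₀ L X) (hdense : BlockDense b q P X) (hb : b₀ ≤ b)
    (hbl : b ≤ l) (hl : l < regroupLevel b q) (hL : l ≤ L) (hv : v ∈ X) :
    ∃ w ∈ team (baseRoute b q l) P, w / 2 ^ l = v / 2 ^ l := by
  have hbL := hbl.trans hL
  unfold baseRoute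
  split_ifs
  · exact hX.exists_mem hdense hb hbl hbL hv
  · have index_lt : l - b < 2 ^ teamExp b q := Nat.sub_lt_left_of_lt_add hbl hl
    exact hX.exists_mem (blockDense_split hdense
      (fun u hu => hX.two_pow_teamExp_le hdense hb hbL hu) index_lt) hb hbl hbL hv

lemma Thick.exists_awake (hX : Thick b₀ L X) (i : ℕ) (hdense : BlockDense b q P X) (hb : b₀ ≤ b)
    (hbl : b ≤ l) (hl : l < finish i b q) (hL : l ≤ L) (hv : v ∈ X) :
    ∃ w ∈ team (route i b q l) P, w / 2 ^ l = v / 2 ^ l := by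
  induction i generalizing b q P with
  | zero => exact hX.exists_awake_base hdense hb hbl hl hL hv
  | succ i ih =>
    rcases lt_trichotomy l (regroupLevel b q) with hlt | rfl | hgt
    · exact route_succ_of_lt hlt ▸ hX.exists_awake_base hdense hb hbl hlt hL hv
    · exact route_succ_regroupLevel i b q ▸ hX.exists_mem hdense hb hbl (hbl.trans hL) hv
    · obtain ⟨r, hr, hstart, hend⟩ := exists_subphase hgt hl
      rw [route_succ_of_mem_subphase hr hstart hend, team_cons]
      have hbc : b ≤ regroupLevel b q := (lt_regroupLevel b q).le
      have hcg := (regroupLevel_lt_subphaseStart i b q r).le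
      have dense_c : BlockDense (regroupLevel b q) q P X := hdense.mono hbc
      have teamExp_le : teamExp b q ≤ teamExp (regroupLevel b q) q :=
        Nat.sub_le_sub_right (Nat.div_le_div_right hbc) q
      have large : ∀ u ∈ X, 2 ^ teamExp b q ≤ #(block (regroupLevel b q) u P) := fun u hu =>
        (Nat.pow_le_pow_right two_pos teamExp_le).trans <|
          hX.two_pow_teamExp_le dense_c (hb.trans hbc) (hgt.le.trans hL) hu
      exact ih ((blockDense_split dense_c large hr).mono hcg) (hb.trans (hbc.trans hcg)) hstart
        (hend.trans_eq (subphaseStart_succ _ b q r))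

end Thick

lemma four_le_teamExp_subphaseStart_zero (f : ℕ → ℕ → ℕ) {b q : ℕ} (he : 4 ≤ teamExp b q) :
    4 ≤ teamExp (subphaseStart f b q 0) (q + teamExp b q + 1) := by
  obtain ⟨d, hd⟩ := Nat.exists_eq_add_of_le he
  have two_pow_eq : 2 ^ teamExp b q = 16 * 2 ^ d := by rw [hd, pow_add]; rfl
  have lt_two_pow := Nat.lt_two_pow_self (n := d)
  simp only [subphaseStart, regroupLevel, two_pow_eq, Function.iterate_zero_apply]
  simp only [teamExp] at hd ⊢
  omega

lemma iterate_ack_le_teamExp_subphaseStart {f : ℕ → ℕ → ℕ} {i b q : ℕ}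
    (hf : ∀ c p, 4 ≤ teamExp c p → ack i (teamExp c p) ≤ teamExp (f c p) p)
    (he : 4 ≤ teamExp b q) (r : ℕ) :
    (ack i)^[r] 1 ≤ teamExp (subphaseStart f b q r) (q + teamExp b q + 1) ∧
      4 ≤ teamExp (subphaseStart f b q r) (q + teamExp b q + 1) := by
  induction r with
  | zero =>
    have four_le := four_le_teamExp_subphaseStart_zero f he
    exact ⟨le_trans (by norm_num) four_le, four_le⟩
  | succ r ih =>
    rw [subphaseStart_succ, Function.iterate_succ_apply']
    have ack_le := hf _ _ ih.2
    exact ⟨(ack_le_ack le_rfl ih.1).trans ack_le, ih.2.trans ((lt_ack_right i _).le.trans ack_le)⟩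

lemma ack_le_teamExp_finish (i : ℕ) {b q : ℕ} (he : 4 ≤ teamExp b q) :
    ack i (teamExp b q) ≤ teamExp (finish i b q) q := by
  induction i generalizing b q with
  | zero =>
    obtain ⟨d, hd⟩ : ∃ d, teamExp b q = d + 1 := ⟨teamExp b q - 1, by omega⟩
    have lt_two_pow := Nat.lt_two_pow_self (n := d)
    simp only [finish, regroupLevel, hd, ack_zero, pow_succ]
    simp only [teamExp] at hd ⊢
    omega
  | succ i ih =>
    calc ack (i + 1) (teamExp b q) = (ack i)^[teamExp b q + 1] 1 := ack_succ_eq_iterate _ _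
      _ ≤ (ack i)^[2 ^ teamExp b q] 1 :=
          Function.monotone_iterate_of_id_le (fun x => (lt_ack_right i x).le)
            Nat.lt_two_pow_self 1
      _ ≤ teamExp (finish (i + 1) b q) (q + teamExp b q + 1) :=
          (iterate_ack_le_teamExp_subphaseStart (fun _ _ => ih) he _).1
      _ ≤ teamExp (finish (i + 1) b q) q := Nat.sub_le_sub_left (by omega) _

/-! ### The channel -/

lemma filterMap_eq_singleton {α β : Type*} {f : α → Option β} {l : List α} {v : α} {m : β}
    (hl : l.Nodup) (hv : v ∈ l) (hm : f v = some m) (hne : ∀ w ∈ l, w ≠ v → f w = none) :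
    l.filterMap f = [m] := by
  obtain ⟨s, t, rfl⟩ := List.append_of_mem hv
  have hnot : v ∉ s ++ t := (List.nodup_cons.1 (List.nodup_middle.1 hl)).1
  have hnil : ∀ r ⊆ s ++ t, r.filterMap f = [] := fun r hr =>
    List.filterMap_eq_nil_iff.2 fun w hw =>
      hne w (List.perm_middle.mem_iff.2 (List.mem_cons_of_mem v (hr hw)))
        (ne_of_mem_of_not_mem (hr hw) hnot)
  rw [List.filterMap_append, hnil s (List.subset_append_left s t), List.filterMap_cons_some hm,
    hnil t (List.subset_append_right s t), List.nil_append]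

lemma SlotAction.cost_le_one (a : SlotAction) : a.cost ≤ 1 := by
  cases a <;> simp [cost]

section Channel

variable {N : ℕ} {S : Finset (Fin N)} {a : Fin N → SlotAction}

lemma channel_eq_some {v : Fin N} {m : Message} (hv : v ∈ S) (hm : (a v).sent = some m)
    (hne : ∀ w ∈ S, w ≠ v → (a w).sent = none) : channel S a = some m := by
  unfold channel
  rw [filterMap_eq_singleton (sort_nodup _ _) ((mem_sort _).2 hv) hm
    fun w hw => hne w ((mem_sort _).1 hw)]

lemma channel_eq_none (hsent : ∀ w ∈ S, (a w).sent = none) : channel S a = none := by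
  unfold channel
  rw [List.filterMap_eq_nil_iff.2 fun w hw => hsent w ((mem_sort _).1 hw)]

lemma exists_sent_of_channel_eq_some {m : Message} (hm : channel S a = some m) :
    ∃ v ∈ S, (a v).sent = some m := by
  unfold channel at hm
  split at hm
  next m' hfilter =>
    obtain rfl := Option.some.inj hm
    obtain ⟨v, hv, hsent⟩ := List.mem_filterMap.1 (hfilter ▸ List.mem_singleton_self m')
    exact ⟨v, (mem_sort _).1 hv, hsent⟩
  next => exact absurd hm (Option.some_ne_none m).symm

end Channel

/-! ### Algorithms described slot by slot -/

/-- The behaviour of a device with states in `σ` in slots that are described by elements of `D`.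
The arguments of type `ℕ` are IDs. -/
structure Machine (σ D : Type) where
  initial : ℕ → σ
  act : D → ℕ → σ → SlotAction
  upd : D → ℕ → σ → Perception → σ
  role : ℕ → σ → Role

namespace Machine

section Run

variable {σ D : Type} (M : Machine σ D) {N : ℕ} (S : Finset (Fin N))

/-- The state of device `v` when the slots are described by `p`, as a function of its perceptions
(most recent first). -/
def state (p : List D) (v : ℕ) : List Perception → σ
  | [] => M.initial v
  | x :: h =>
    match p[h.length]? with
    | some d => M.upd d v (state p v h) x
    | none => state p v h

/-- The states of all devices before the first slot. -/
def start (v : Fin N) : σ :=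
  M.initial v

/-- The actions of all devices in one slot. -/
def acts (d : D) (c : Fin N → σ) (v : Fin N) : SlotAction :=
  M.act d v (c v)

/-- The states of all devices after one more slot. -/
def step (d : D) (c : Fin N → σ) (v : Fin N) : σ :=
  M.upd d v (c v) (perceive (M.acts d c v) (channel S (M.acts d c)))

/-- The states of all devices after a list of slots. -/
def run (p : List D) (c : Fin N → σ) : Fin N → σ :=
  p.foldl (fun c d => M.step S d c) c

/-- The energy that a device spends in a list of slots. -/
def spent : List D → (Fin N → σ) → Fin N → ℕ
  | [], _, _ => 0
  | d :: p, c, v => (M.acts d c v).cost + spent p (M.step S d c) v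

lemma run_cons (d : D) (p : List D) (c : Fin N → σ) :
    M.run S (d :: p) c = M.run S p (M.step S d c) := rfl

lemma run_append (p p' : List D) (c : Fin N → σ) :
    M.run S (p ++ p') c = M.run S p' (M.run S p c) :=
  List.foldl_append

lemma run_concat (p : List D) (d : D) (c : Fin N → σ) :
    M.run S (p ++ [d]) c = M.step S d (M.run S p c) :=
  M.run_append S p [d] c

lemma run_induction {p : List D} {motive : (Fin N → σ) → Prop}
    (hstep : ∀ d ∈ p, ∀ c, motive c → motive (M.step S d c)) {c : Fin N → σ} (hc : motive c) :
    motive (M.run S p c) := by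
  induction p generalizing c with
  | nil => exact hc
  | cons d p ih =>
    exact ih (fun d' hd' => hstep d' (List.mem_cons_of_mem d hd')) (hstep d List.mem_cons_self c hc)

lemma spent_append (p p' : List D) (c : Fin N → σ) (v : Fin N) :
    M.spent S (p ++ p') c v = M.spent S p c v + M.spent S p' (M.run S p c) v := by
  induction p generalizing c with
  | nil => exact (zero_add _).symm
  | cons d p ih => simp only [List.cons_append, spent, run_cons, ih, add_assoc]

lemma spent_singleton (d : D) (c : Fin N → σ) (v : Fin N) :
    M.spent S [d] c v = (M.acts d c v).cost := rfl

lemma spent_map_le_card {ι : Type*} {slot : ι → D} {U : List ι} (hU : U.Nodup)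
    {v : Fin N} {A : Finset ι} {K : σ → Prop}
    (hupd : ∀ u ∈ U, ∀ s x, K s → K (M.upd (slot u) v s x))
    (hidle : ∀ u ∈ U, u ∉ A → ∀ s, K s → M.act (slot u) v s = SlotAction.idle)
    {c : Fin N → σ} (hc : K (c v)) : M.spent S (U.map slot) c v ≤ #A := by
  classical
  induction U generalizing c A with
  | nil => exact Nat.zero_le _
  | cons u U ih =>
    obtain ⟨hu, hU⟩ := List.nodup_cons.1 hU
    have spent_tail : M.spent S (U.map slot) (M.step S (slot u) c) v ≤ #(A.erase u) :=
      ih hU (fun w hw => hupd w (List.mem_cons_of_mem u hw))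
        (fun w hw hwA => hidle w (List.mem_cons_of_mem u hw) fun hwA' =>
          hwA (mem_erase.2 ⟨ne_of_mem_of_not_mem hw hu, hwA'⟩))
        (hupd u List.mem_cons_self _ _ hc)
    simp only [List.map_cons, spent]
    by_cases huA : u ∈ A
    · rw [← card_erase_add_one huA, add_comm]
      exact add_le_add spent_tail (SlotAction.cost_le_one _)
    · have cost_eq : (M.acts (slot u) c v).cost = 0 := by
        rw [acts, hidle u List.mem_cons_self huA _ hc, SlotAction.cost]
      rwa [cost_eq, zero_add, ← erase_eq_of_notMem huA]

end Run

section ToAlgorithm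

variable {σ D : Type} {N : ℕ} (S : Finset (Fin N)) (M : ℕ → Machine σ D) (p : ℕ → List D)

/-- The algorithm in which the devices behave as described by a machine. -/
def toAlgorithm : Algorithm where
  time N := (p N).length
  act N v h :=
    match (p N)[h.length]? with
    | some d => (M N).act d v ((M N).state (p N) v h)
    | none => SlotAction.idle
  role N v h := (M N).role v ((M N).state (p N) v h)

lemma length_history (A : Algorithm) (t : ℕ) (v : Fin N) : (A.history S t v).length = t := by
  induction t with
  | zero => rfl
  | succ t ih => simp only [Algorithm.history, List.length_cons, ih]

lemma toAlgorithm_act {t : ℕ} (ht : t < (p N).length) {v : Fin N} {h : List Perception}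
    (hh : h.length = t) :
    (toAlgorithm M p).act N v h = (M N).act (p N)[t] v ((M N).state (p N) v h) := by
  subst hh
  simp only [toAlgorithm, List.getElem?_eq_getElem ht]

lemma state_history {t : ℕ} (ht : t ≤ (p N).length) (v : Fin N) :
    (M N).state (p N) v ((toAlgorithm M p).history S t v) =
      (M N).run S ((p N).take t) (M N).start v := by
  induction t generalizing v with
  | zero => rfl
  | succ t ih =>
    have ht' : t < (p N).length := ht
    have act_eq : ∀ w : Fin N, (toAlgorithm M p).act N w ((toAlgorithm M p).history S t w) =
        (M N).acts (p N)[t] ((M N).run S ((p N).take t) (M N).start) w := fun w => by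
      rw [toAlgorithm_act M p ht' (length_history S _ t w), ih ht'.le, acts]
    rw [List.take_succ_eq_append_getElem ht', run_concat]
    simp only [Algorithm.history, state, length_history, List.getElem?_eq_getElem ht', act_eq,
      ih ht'.le, step]

lemma action_eq {t : ℕ} (ht : t < (p N).length) (v : Fin N) :
    (toAlgorithm M p).action S t v =
      (M N).acts (p N)[t] ((M N).run S ((p N).take t) (M N).start) v := by
  rw [Algorithm.action, toAlgorithm_act M p ht (length_history S _ t v), state_history S M p ht.le,
    acts]

lemma action_last {q : List D} {d : D} (hp : p N = q ++ [d]) (v : Fin N) :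
    (toAlgorithm M p).action S q.length v = (M N).acts d ((M N).run S q (M N).start) v := by
  have ht : q.length < (p N).length := by rw [hp, List.length_append]; exact Nat.lt_succ_self _
  simp only [action_eq S M p ht, hp, List.take_left, List.getElem_concat_length]

lemma finalRole_eq (v : Fin N) :
    (toAlgorithm M p).finalRole S v = (M N).role v ((M N).run S (p N) (M N).start v) := by
  have hstate := state_history S M p le_rfl v
  rw [List.take_length] at hstate
  exact congrArg ((M N).role v) hstate

lemma energy_eq (v : Fin N) :
    (toAlgorithm M p).energy S v = (M N).spent S (p N) (M N).start v := by
  have energy_take : ∀ n ≤ (p N).length,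
      ∑ t ∈ range n, ((toAlgorithm M p).action S t v).cost =
        (M N).spent S ((p N).take n) (M N).start v := by
    intro n
    induction n with
    | zero => intro _; rfl
    | succ n ih =>
      intro hn
      rw [sum_range_succ, ih (Nat.le_of_succ_le hn), List.take_succ_eq_append_getElem hn,
        spent_append, action_eq S M p hn, spent_singleton]
  have energy_all := energy_take _ le_rfl
  rwa [List.take_length] at energy_all

end ToAlgorithm

end Machine

/-! ### The algorithm -/

/-- The set of IDs of the devices in `S`. -/
def ids {N : ℕ} (S : Finset (Fin N)) : Finset ℕ :=
  S.map Fin.valEmbedding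

lemma mem_ids {N : ℕ} {S : Finset (Fin N)} {x : ℕ} : x ∈ ids S ↔ ∃ v ∈ S, (v : ℕ) = x := by
  simp [ids]

lemma val_mem_ids {N : ℕ} {S : Finset (Fin N)} {v : Fin N} : (v : ℕ) ∈ ids S ↔ v ∈ S := by
  simp [ids, Fin.val_inj]

/-- `v` is the first element of `P` in its block of level `l`. -/
def IsFirst (l : ℕ) (P : Finset ℕ) (v : ℕ) : Prop :=
  v ∈ P ∧ ∀ w ∈ P, w / 2 ^ l = v / 2 ^ l → v ≤ w

instance (l : ℕ) (P : Finset ℕ) (v : ℕ) : Decidable (IsFirst l P v) :=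
  inferInstanceAs (Decidable (_ ∧ _))

lemma exists_isFirst (l : ℕ) {v : ℕ} {P : Finset ℕ} (hv : v ∈ P) :
    ∃ w, IsFirst l P w ∧ w / 2 ^ l = v / 2 ^ l := by
  have hne : (block l v P).Nonempty := ⟨v, mem_block_self.2 hv⟩
  obtain ⟨hmem, hblock⟩ := mem_block.1 (min'_mem _ hne)
  exact ⟨(block l v P).min' hne,
    ⟨hmem, fun w hw hwv => min'_le _ _ (mem_block.2 ⟨hw, hwv.trans hblock⟩)⟩, hblock⟩

lemma IsFirst.eq {l v w : ℕ} {P : Finset ℕ} (hv : IsFirst l P v) (hw : IsFirst l P w)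
    (hwv : w / 2 ^ l = v / 2 ^ l) : w = v :=
  le_antisymm (hw.2 v hv.1 hwv.symm) (hv.2 w hw.1 hwv)

lemma isFirst_block {l v : ℕ} {P : Finset ℕ} : IsFirst l (block l v P) v ↔ IsFirst l P v := by
  simp only [IsFirst, mem_block, and_true]
  exact and_congr_right fun _ => forall_congr' fun w => by tauto

/-- `v` is the last element of `P`. -/
def IsLast (P : Finset ℕ) (v : ℕ) : Prop :=
  v ∈ P ∧ rank P v + 1 = #P

instance (P : Finset ℕ) (v : ℕ) : Decidable (IsLast P v) :=
  inferInstanceAs (Decidable (_ ∧ _))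

lemma exists_isLast {P : Finset ℕ} (hP : P.Nonempty) : ∃ v, IsLast P v := by
  obtain ⟨v, hv, hrank⟩ := exists_rank_eq (Nat.sub_lt hP.card_pos Nat.one_pos)
  exact ⟨v, hv, by rw [hrank, Nat.sub_add_cancel hP.card_pos]⟩

lemma IsLast.eq {P : Finset ℕ} {v w : ℕ} (hv : IsLast P v) (hw : IsLast P w) : v = w :=
  rank_injOn P hv.1 hw.1 (Nat.succ_injective (hv.2.trans hw.2.symm))

/-- The state of a device: the latest roster of its block that it knows (`∅` if the block has been
given up), and the IDs that it has heard of since. -/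
structure Device where
  roster : Finset ℕ
  acc : Finset ℕ

/-- The kinds of slots: block `u` of level `l` reports its roster; the devices draw conclusions
from the reports of level `l`; device `x` reports its own ID; the device of rank `r` forwards what
it has collected to the next one; the announcement. -/
inductive Slot where
  | report (l u : ℕ)
  | commit (l : ℕ)
  | call (x : ℕ)
  | pass (r : ℕ)
  | announce

/-- The parameters of the algorithm: which team is awake at which level, how many devices a block
must contain in order to survive, the number of levels, and the number of calls that a device
receives at the end. -/
structure Plan where
  path : ℕ → List Split
  thr : ℕ → ℕ
  top : ℕ
  load : ℕ

/-- The IDs contained in a perceived message. -/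
def heardIds : Perception → Finset ℕ
  | Perception.nothing => ∅
  | Perception.silence => ∅
  | Perception.heard m => m.toFinset

namespace Plan

variable (pl : Plan)

/-- The members of `P` that are awake at level `l`. -/
def awake (l : ℕ) (P : Finset ℕ) : Finset ℕ :=
  team (pl.path l) P

/-- What a device knows about its block of level `l + 1` after the reports of level `l`. -/
def known (l v : ℕ) (s : Device) : Finset ℕ :=
  s.acc ∪ if v ∈ pl.awake l s.roster then s.roster else ∅

/-- The action of device `v` in a slot. -/
def act : Slot → ℕ → Device → SlotAction
  | Slot.report l u, v, s =>
    if v / 2 ^ l = u ∧ IsFirst l (pl.awake l s.roster) v then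
      SlotAction.transmit (s.roster.sort (· ≤ ·))
    else if v / 2 ^ (l + 1) = u / 2 ∧ v ∈ pl.awake (l + 1) s.roster then SlotAction.listen
    else SlotAction.idle
  | Slot.commit _, _, _ => SlotAction.idle
  | Slot.call x, v, s =>
    if v = x then SlotAction.transmit [x]
    else if v ∈ s.roster ∧ rank s.roster v = x / pl.load then SlotAction.listen
    else SlotAction.idle
  | Slot.pass r, v, s =>
    if v ∈ s.roster ∧ rank s.roster v = r then
      SlotAction.transmit ((s.roster ∪ s.acc).sort (· ≤ ·))
    else if v ∈ s.roster ∧ rank s.roster v = r + 1 then SlotAction.listen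
    else SlotAction.idle
  | Slot.announce, v, s =>
    if IsLast s.roster v then SlotAction.transmit ((s.roster ∪ s.acc).sort (· ≤ ·))
    else SlotAction.listen

/-- The new state of device `v` after a slot. -/
def upd : Slot → ℕ → Device → Perception → Device
  | Slot.commit l, v, s, _ =>
    if v ∈ pl.awake (l + 1) s.roster then
      if v ∈ pl.known l v s ∧ pl.thr (l + 1) ≤ #(pl.known l v s) then ⟨pl.known l v s, ∅⟩
      else ⟨∅, ∅⟩
    else ⟨s.roster, ∅⟩
  | _, _, s, x => ⟨s.roster, s.acc ∪ heardIds x⟩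

/-- The behaviour of the devices under a plan. -/
def machine : Machine Device Slot where
  initial v := ⟨{v}, ∅⟩
  act := pl.act
  upd := pl.upd
  role v s := if IsLast s.roster v then Role.leader else Role.follower

/-- The slots of level `l`. -/
def levelSlots (l : ℕ) : List Slot :=
  (List.range (2 ^ (pl.top - l))).map (Slot.report l) ++ [Slot.commit l]

/-- The slots of the first `l` levels. -/
def slotsBelow : ℕ → List Slot
  | 0 => []
  | l + 1 => slotsBelow l ++ pl.levelSlots l

/-- The devices that take part at level `l`, if `X` is the set of all devices. -/
def alive (X : Finset ℕ) : ℕ → Finset ℕ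
  | 0 => X
  | l + 1 => {v ∈ alive X l | pl.thr (l + 1) ≤ #(block (l + 1) v (alive X l))}

/-- What is required of a plan if `X` is the set of devices: `E` bounds the number of levels at
which a device is awake. -/
structure Sound (X : Finset ℕ) (E : ℕ) : Prop where
  consistent : ∀ l ≤ pl.top, ∀ p p' s, pl.path l = p ++ s :: p' →
    s.level < l ∧ pl.path s.level = p
  path_top : pl.path pl.top = []
  exists_awake : ∀ l ≤ pl.top, ∀ v ∈ pl.alive X l,
    ∃ w ∈ pl.awake l (pl.alive X l), w / 2 ^ l = v / 2 ^ l
  card_awake : ∀ P v, #{l ∈ range (pl.top + 1) | v ∈ pl.awake l P} ≤ E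

variable {pl} {X : Finset ℕ}

lemma alive_succ_subset (l : ℕ) : pl.alive X (l + 1) ⊆ pl.alive X l :=
  filter_subset _ _

lemma alive_subset (l : ℕ) : pl.alive X l ⊆ X := by
  induction l with
  | zero => exact Subset.rfl
  | succ l ih => exact (alive_succ_subset l).trans ih

lemma mem_alive_succ {l v : ℕ} : v ∈ pl.alive X (l + 1) ↔
    v ∈ pl.alive X l ∧ pl.thr (l + 1) ≤ #(block (l + 1) v (pl.alive X l)) :=
  mem_filter

lemma block_alive_succ {l v : ℕ} (hv : v ∈ pl.alive X (l + 1)) :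
    block (l + 1) v (pl.alive X (l + 1)) = block (l + 1) v (pl.alive X l) := by
  ext w
  rw [mem_block, mem_block, mem_alive_succ]
  refine ⟨fun hw => ⟨hw.1.1, hw.2⟩, fun hw => ⟨⟨hw.1, ?_⟩, hw.2⟩⟩
  rw [block_congr hw.2]
  exact (mem_alive_succ.1 hv).2

lemma thr_le_card_block {k l v : ℕ} (hk : 0 < k) (hkl : k ≤ l) (hv : v ∈ pl.alive X l) :
    pl.thr k ≤ #(block k v (pl.alive X l)) := by
  induction l, hkl using Nat.le_induction with
  | base =>
    obtain ⟨k, rfl⟩ := Nat.exists_eq_succ_of_ne_zero hk.ne'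
    rw [block_alive_succ hv]
    exact (mem_alive_succ.1 hv).2
  | succ l hkl ih =>
    rw [block_eq_block_of_le (Nat.le_succ_of_le hkl) (block_alive_succ hv)]
    exact ih (alive_succ_subset l hv)

lemma awake_subset (l : ℕ) (P : Finset ℕ) : pl.awake l P ⊆ P :=
  team_subset _ _

lemma forall_or_exists_first {α : Type*} (Q : α → Prop) (l : List α) :
    (∀ s ∈ l, Q s) ∨ ∃ p s p', l = p ++ s :: p' ∧ (∀ s' ∈ p, Q s') ∧ ¬ Q s := by
  induction l with
  | nil => simp
  | cons a l ih =>
    by_cases ha : Q a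
    · rcases ih with hl | ⟨p, s, p', rfl, hp, hs⟩
      · exact Or.inl (List.forall_mem_cons.2 ⟨ha, hl⟩)
      · exact Or.inr ⟨a :: p, s, p', rfl, List.forall_mem_cons.2 ⟨ha, hp⟩, hs⟩
    · exact Or.inr ⟨[], a, l, rfl, List.forall_mem_nil _, ha⟩

variable {E : ℕ}

lemma Sound.level_lt (hpl : pl.Sound X E) {l : ℕ} (hl : l ≤ pl.top) {s : Split}
    (hs : s ∈ pl.path l) : s.level < l := by
  obtain ⟨p, p', hp⟩ := List.append_of_mem hs
  exact (hpl.consistent l hl p p' s hp).1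

lemma Sound.block_awake (hpl : pl.Sound X E) {l : ℕ} (hl : l ≤ pl.top) (v : ℕ) (P : Finset ℕ) :
    block l v (pl.awake l P) = pl.awake l (block l v P) :=
  block_team (fun _ hs => (hpl.level_lt hl hs).le) _ _

/-- A device that has been asleep since it learnt its roster of level `k` can still tell whether it
is awake: the first instruction of a level above `k` is meant for the devices that are awake at that
level, to which it does not belong. -/
lemma Sound.mem_awake_iff (hpl : pl.Sound X E) {k l j v : ℕ} {P R : Finset ℕ}
    (hR : block k v R = block k v P) (hasleep : ∀ i, k < i → i ≤ l → v ∉ pl.awake i R)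
    (hj : j ≤ l + 1) (hjt : j ≤ pl.top) : v ∈ pl.awake j R ↔ v ∈ pl.awake j P := by
  rcases forall_or_exists_first (fun s : Split => s.level ≤ k) (pl.path j) with
    hlow | ⟨p, s, p', hpath, hlow, hs⟩
  · exact mem_team_congr hlow hR
  · obtain ⟨hsj, hsp⟩ := hpl.consistent j hjt p p' s hpath
    have notMem_R : v ∉ team p R := hsp ▸ hasleep s.level (not_le.1 hs) (by omega)
    have notMem_P : v ∉ team p P := fun hv => notMem_R ((mem_team_congr hlow hR).2 hv)
    rw [awake, awake, hpath, team_append, team_append]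
    exact iff_of_false (fun hv => notMem_R (team_subset _ _ hv))
      (fun hv => notMem_P (team_subset _ _ hv))

section Run

variable {N : ℕ} {S : Finset (Fin N)}

lemma roster_run_of_commit_notMem {p : List Slot} (hp : ∀ l, Slot.commit l ∉ p)
    (c : Fin N → Device) (v : Fin N) : (pl.machine.run S p c v).roster = (c v).roster := by
  refine pl.machine.run_induction S (motive := fun c' => (c' v).roster = (c v).roster)
    (fun d hd c' hc' => ?_) rfl
  cases d with
  | commit l => exact absurd hd (hp l)
  | _ => exact hc'

lemma acc_subset_acc_run {p : List Slot} (hp : ∀ l, Slot.commit l ∉ p) (c : Fin N → Device)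
    (v : Fin N) : (c v).acc ⊆ (pl.machine.run S p c v).acc := by
  refine pl.machine.run_induction S (motive := fun c' => (c v).acc ⊆ (c' v).acc)
    (fun d hd c' hc' => ?_) Subset.rfl
  cases d with
  | commit l => exact absurd hd (hp l)
  | _ => exact hc'.trans subset_union_left

end Run

end Plan

/-! ### Correctness of the merging of blocks -/

lemma div_two_pow_succ (x l : ℕ) : x / 2 ^ (l + 1) = x / 2 ^ l / 2 := by
  rw [pow_succ, Nat.div_div_eq_div_mul]

lemma heardIds_perceive_listen (o : Option Message) :
    heardIds (perceive SlotAction.listen o) = o.elim ∅ List.toFinset := by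
  cases o <;> rfl

namespace Plan

variable {pl : Plan} {N E l : ℕ} {S : Finset (Fin N)} {c : Fin N → Device} {v : Fin N}

variable (pl S) in
/-- What the active devices know at the beginning of level `l`: a device that takes part knows its
block of the last level at which it was awake, and a device whose block has been given up does not
consider itself awake. -/
def Informed (l : ℕ) (c : Fin N → Device) : Prop :=
  ∀ v ∈ S,
    ((v : ℕ) ∈ pl.alive (ids S) l → ∃ k ≤ l, (c v).roster = block k v (pl.alive (ids S) l) ∧
      ∀ j, k < j → j ≤ l → (v : ℕ) ∉ pl.awake j (c v).roster) ∧
    ((v : ℕ) ∉ pl.alive (ids S) l → (v : ℕ) ∉ pl.awake l (c v).roster)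

section Informed

variable (hc : pl.Informed S l c)
include hc

lemma Informed.mem_alive (hv : v ∈ S) (hawake : (v : ℕ) ∈ pl.awake l (c v).roster) :
    (v : ℕ) ∈ pl.alive (ids S) l :=
  not_not.1 fun hdead => (hc v hv).2 hdead hawake

lemma Informed.roster_eq (hv : v ∈ S) (hawake : (v : ℕ) ∈ pl.awake l (c v).roster) :
    (c v).roster = block l v (pl.alive (ids S) l) := by
  obtain ⟨k, hk, hroster, hasleep⟩ := (hc v hv).1 (hc.mem_alive hv hawake)
  rcases hk.lt_or_eq with hk | rfl
  · exact absurd hawake (hasleep l hk le_rfl)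
  · exact hroster

lemma Informed.mem_awake_iff (hpl : pl.Sound (ids S) E) (hv : v ∈ S)
    (halive : (v : ℕ) ∈ pl.alive (ids S) l) {j : ℕ} (hj : j ≤ l + 1) (hjt : j ≤ pl.top) :
    (v : ℕ) ∈ pl.awake j (c v).roster ↔ (v : ℕ) ∈ pl.awake j (pl.alive (ids S) l) := by
  obtain ⟨k, _, hroster, hasleep⟩ := (hc v hv).1 halive
  refine hpl.mem_awake_iff (k := k) ?_ hasleep hj hjt
  rw [hroster, block_block le_rfl]

lemma Informed.isFirst_iff (hpl : pl.Sound (ids S) E) (hl : l ≤ pl.top) (hv : v ∈ S) :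
    IsFirst l (pl.awake l (c v).roster) v ↔ IsFirst l (pl.awake l (pl.alive (ids S) l)) v := by
  by_cases hawake : (v : ℕ) ∈ pl.awake l (c v).roster
  · rw [hc.roster_eq hv hawake, ← hpl.block_awake hl, isFirst_block]
  · refine iff_of_false (fun hfirst => hawake hfirst.1) fun hfirst => hawake ?_
    exact (hc.mem_awake_iff hpl hv (awake_subset _ _ hfirst.1) (Nat.le_succ l) hl).2 hfirst.1

lemma Informed.exists_reporter (hpl : pl.Sound (ids S) E) (hl : l ≤ pl.top) {w : ℕ}
    (hw : w ∈ pl.alive (ids S) l) :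
    ∃ v ∈ S, IsFirst l (pl.awake l (c v).roster) v ∧ (v : ℕ) / 2 ^ l = w / 2 ^ l := by
  obtain ⟨u, hu, huw⟩ := hpl.exists_awake l hl w hw
  obtain ⟨x, hx, hxu⟩ := exists_isFirst l hu
  obtain ⟨v, hv, rfl⟩ := mem_ids.1 (alive_subset _ (awake_subset _ _ hx.1))
  exact ⟨v, hv, (hc.isFirst_iff hpl hl hv).2 hx, hxu.trans huw⟩

end Informed

lemma sent_report_eq_none {u : ℕ}
    (hv : ¬ ((v : ℕ) / 2 ^ l = u ∧ IsFirst l (pl.awake l (c v).roster) v)) :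
    (pl.machine.acts (Slot.report l u) c v).sent = none := by
  simp only [Machine.acts, machine, act, if_neg hv]
  split_ifs <;> rfl

lemma channel_report_eq_some (hpl : pl.Sound (ids S) E) (hl : l ≤ pl.top)
    (hc : pl.Informed S l c) {w : ℕ} (hw : w ∈ pl.alive (ids S) l) :
    channel S (pl.machine.acts (Slot.report l (w / 2 ^ l)) c) =
      some ((block l w (pl.alive (ids S) l)).sort (· ≤ ·)) := by
  obtain ⟨v, hv, hfirst, hvw⟩ := hc.exists_reporter hpl hl hw
  refine channel_eq_some hv ?_ fun z hz hzv => sent_report_eq_none fun hreport => hzv (Fin.ext ?_)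
  · simp only [Machine.acts, machine, act, if_pos (And.intro hvw hfirst), SlotAction.sent]
    rw [hc.roster_eq hv hfirst.1, block_congr hvw]
  · exact ((hc.isFirst_iff hpl hl hv).1 hfirst).eq ((hc.isFirst_iff hpl hl hz).1 hreport.2)
      (hreport.1.trans hvw.symm)

lemma channel_report_eq_none (hc : pl.Informed S l c) {u : ℕ}
    (hu : ∀ w ∈ pl.alive (ids S) l, w / 2 ^ l ≠ u) :
    channel S (pl.machine.acts (Slot.report l u) c) = none :=
  channel_eq_none fun v hv => sent_report_eq_none fun hreport =>
    hu v (hc.mem_alive hv hreport.2.1) hreport.1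

lemma heardIds_report (hpl : pl.Sound (ids S) E) (hl : l ≤ pl.top) (hc : pl.Informed S l c)
    (u : ℕ) :
    heardIds (perceive SlotAction.listen (channel S (pl.machine.acts (Slot.report l u) c))) =
      {w ∈ pl.alive (ids S) l | w / 2 ^ l = u} := by
  rw [heardIds_perceive_listen]
  by_cases hu : ∃ w ∈ pl.alive (ids S) l, w / 2 ^ l = u
  · obtain ⟨w, hw, rfl⟩ := hu
    rw [channel_report_eq_some hpl hl hc hw, Option.elim_some, sort_toFinset, block]
  · push Not at hu
    rw [channel_report_eq_none hc hu, filter_false_of_mem hu, Option.elim_none]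

lemma known_step_report (hpl : pl.Sound (ids S) E) (hl : l ≤ pl.top) (hc : pl.Informed S l c)
    (u : ℕ) (hv : v ∈ S) (hawake : (v : ℕ) ∈ pl.awake (l + 1) (c v).roster) :
    pl.known l v (pl.machine.step S (Slot.report l u) c v) =
      pl.known l v (c v) ∪ {w ∈ block (l + 1) v (pl.alive (ids S) l) | w / 2 ^ l = u} := by
  have known_step : pl.known l v (pl.machine.step S (Slot.report l u) c v) = pl.known l v (c v) ∪
      heardIds (perceive (pl.act (Slot.report l u) v (c v))
        (channel S (pl.machine.acts (Slot.report l u) c))) := union_right_comm _ _ _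
  rw [known_step]
  by_cases hreport : (v : ℕ) / 2 ^ l = u ∧ IsFirst l (pl.awake l (c v).roster) v
  · have subset_known : {w ∈ block (l + 1) v (pl.alive (ids S) l) | w / 2 ^ l = u} ⊆
        pl.known l v (c v) := fun w hw => by
      obtain ⟨hmem, hwu⟩ := mem_filter.1 hw
      rw [known, if_pos hreport.2.1, hc.roster_eq hv hreport.2.1]
      exact mem_union_right _ (mem_block.2 ⟨(mem_block.1 hmem).1, hwu.trans hreport.1.symm⟩)
    rw [union_eq_left.2 subset_known, act, if_pos hreport, perceive, heardIds, union_empty]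
  · congr 1
    simp only [act, if_neg hreport]
    by_cases hparent : (v : ℕ) / 2 ^ (l + 1) = u / 2
    · rw [if_pos ⟨hparent, hawake⟩, heardIds_report hpl hl hc, block, filter_filter]
      refine filter_congr fun w _ => (and_iff_right_of_imp fun hwu => ?_).symm
      rw [hparent, div_two_pow_succ, hwu]
    · rw [if_neg fun hlisten => hparent hlisten.1, perceive, heardIds, filter_false_of_mem]
      intro w hw hwu
      rw [← hwu, ← div_two_pow_succ] at hparent
      exact hparent (mem_block.1 hw).2.symm

lemma known_run_reports (hpl : pl.Sound (ids S) E) (hl : l ≤ pl.top) (hc : pl.Informed S l c)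
    (U : List ℕ) (hv : v ∈ S) (hawake : (v : ℕ) ∈ pl.awake (l + 1) (c v).roster) :
    pl.known l v (pl.machine.run S (U.map (Slot.report l)) c v) =
      pl.known l v (c v) ∪ {w ∈ block (l + 1) v (pl.alive (ids S) l) | w / 2 ^ l ∈ U} := by
  induction U generalizing c with
  | nil => simp [Machine.run]
  | cons u U ih =>
    have informed_step : pl.Informed S l (pl.machine.step S (Slot.report l u) c) := hc
    rw [List.map_cons, Machine.run_cons, ih informed_step hawake,
      known_step_report hpl hl hc u hv hawake, union_assoc, ← filter_or]
    simp only [List.mem_cons]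

/-- The devices that are woken at level `l + 1` have heard the reports of both halves of their
block. -/
lemma known_eq_block (hpl : pl.Sound (ids S) E) (hl : l < pl.top) (hN : N ≤ 2 ^ pl.top)
    (hc : pl.Informed S l c) (hacc : (c v).acc = ∅) (hv : v ∈ S)
    (hawake : (v : ℕ) ∈ pl.awake (l + 1) (c v).roster) :
    pl.known l v
        (pl.machine.run S ((List.range (2 ^ (pl.top - l))).map (Slot.report l)) c v) =
      block (l + 1) v (pl.alive (ids S) l) := by
  have known_subset : pl.known l v (c v) ⊆ block (l + 1) v (pl.alive (ids S) l) := by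
    rw [known, hacc, empty_union]
    split_ifs with hawake_l
    · rw [hc.roster_eq hv hawake_l, ← block_block (Nat.le_succ l)]
      exact filter_subset _ _
    · exact empty_subset _
  have reporting : ∀ w ∈ block (l + 1) v (pl.alive (ids S) l),
      w / 2 ^ l ∈ List.range (2 ^ (pl.top - l)) := fun w hw => by
    obtain ⟨x, _, rfl⟩ := mem_ids.1 (alive_subset _ (mem_block.1 hw).1)
    refine List.mem_range.2 (Nat.div_lt_of_lt_mul ?_)
    rw [← pow_add, Nat.add_sub_cancel' hl.le]
    exact x.2.trans_le hN
  rw [known_run_reports hpl hl.le hc _ hv hawake, filter_true_of_mem reporting,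
    union_eq_right.2 known_subset]

lemma run_levelSlots (l : ℕ) (c : Fin N → Device) (v : Fin N) :
    pl.machine.run S (pl.levelSlots l) c v = pl.upd (Slot.commit l) v
      (pl.machine.run S ((List.range (2 ^ (pl.top - l))).map (Slot.report l)) c v)
      Perception.nothing := by
  rw [levelSlots, Machine.run_concat]
  rfl

lemma acc_run_levelSlots (l : ℕ) (c : Fin N → Device) (v : Fin N) :
    (pl.machine.run S (pl.levelSlots l) c v).acc = ∅ := by
  rw [run_levelSlots, upd]
  split_ifs <;> rfl

lemma roster_run_levelSlots_of_notMem (hasleep : (v : ℕ) ∉ pl.awake (l + 1) (c v).roster) :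
    (pl.machine.run S (pl.levelSlots l) c v).roster = (c v).roster := by
  rw [run_levelSlots, upd, roster_run_of_commit_notMem (by simp), if_neg hasleep]

lemma roster_run_levelSlots_of_mem (hpl : pl.Sound (ids S) E) (hl : l < pl.top)
    (hN : N ≤ 2 ^ pl.top) (hc : pl.Informed S l c) (hacc : (c v).acc = ∅) (hv : v ∈ S)
    (hawake : (v : ℕ) ∈ pl.awake (l + 1) (c v).roster) :
    (pl.machine.run S (pl.levelSlots l) c v).roster =
      if (v : ℕ) ∈ pl.alive (ids S) (l + 1) then block (l + 1) v (pl.alive (ids S) (l + 1))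
      else ∅ := by
  rw [run_levelSlots, upd, roster_run_of_commit_notMem (by simp), if_pos hawake,
    known_eq_block hpl hl hN hc hacc hv hawake]
  simp only [mem_block_self]
  by_cases halive : (v : ℕ) ∈ pl.alive (ids S) (l + 1)
  · rw [if_pos (mem_alive_succ.1 halive), if_pos halive, block_alive_succ halive]
  · rw [if_neg fun hthr => halive (mem_alive_succ.2 hthr), if_neg halive]

lemma informed_start : pl.Informed S 0 pl.machine.start := by
  intro v hv
  have roster_eq : {(v : ℕ)} = block 0 v (pl.alive (ids S) 0) := by
    ext w
    simp only [mem_singleton, mem_block, pow_zero, Nat.div_one, alive]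
    exact ⟨fun hwv => ⟨hwv ▸ val_mem_ids.2 hv, hwv⟩, fun hw => hw.2⟩
  exact ⟨fun _ => ⟨0, le_rfl, roster_eq, fun j hj hj' => absurd hj' hj.not_ge⟩,
    fun hdead => absurd (val_mem_ids.2 hv) hdead⟩

lemma Informed.run_levelSlots (hpl : pl.Sound (ids S) E) (hl : l < pl.top) (hN : N ≤ 2 ^ pl.top)
    (hc : pl.Informed S l c) (hacc : ∀ v ∈ S, (c v).acc = ∅) :
    pl.Informed S (l + 1) (pl.machine.run S (pl.levelSlots l) c) := by
  intro v hv
  by_cases hawake : (v : ℕ) ∈ pl.awake (l + 1) (c v).roster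
  · rw [roster_run_levelSlots_of_mem hpl hl hN hc (hacc v hv) hv hawake]
    split_ifs with halive
    · exact ⟨fun _ => ⟨l + 1, le_rfl, rfl, fun j hj hj' => absurd hj' hj.not_ge⟩,
        fun hdead => absurd halive hdead⟩
    · exact ⟨fun halive' => absurd halive' halive,
        fun _ hmem => notMem_empty _ (awake_subset _ _ hmem)⟩
  · rw [roster_run_levelSlots_of_notMem hawake]
    refine ⟨fun halive => ?_, fun _ => hawake⟩
    obtain ⟨k, hk, hroster, hasleep⟩ := (hc v hv).1 (alive_succ_subset l halive)
    refine ⟨k, hk.trans (Nat.le_succ l), ?_, fun j hkj hjl => ?_⟩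
    · rw [hroster, block_eq_block_of_le (hk.trans (Nat.le_succ l)) (block_alive_succ halive)]
    · rcases hjl.lt_or_eq with hjl | rfl
      · exact hasleep j hkj (Nat.le_of_lt_succ hjl)
      · exact hawake

variable (pl S) in
/-- The states of the devices at the beginning of level `l`. -/
def configAt (l : ℕ) : Fin N → Device :=
  pl.machine.run S (pl.slotsBelow l) pl.machine.start

lemma configAt_succ (l : ℕ) :
    pl.configAt S (l + 1) = pl.machine.run S (pl.levelSlots l) (pl.configAt S l) :=
  Machine.run_append _ _ _ _ _

lemma acc_configAt (l : ℕ) (v : Fin N) : (pl.configAt S l v).acc = ∅ := by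
  cases l with
  | zero => rfl
  | succ l => rw [configAt_succ, acc_run_levelSlots]

lemma informed_configAt (hpl : pl.Sound (ids S) E) (hl : l ≤ pl.top) (hN : N ≤ 2 ^ pl.top) :
    pl.Informed S l (pl.configAt S l) := by
  induction l with
  | zero => exact informed_start
  | succ l ih =>
    rw [configAt_succ]
    exact (ih (Nat.le_of_succ_le hl)).run_levelSlots hpl hl hN fun v _ => acc_configAt l v

end Plan

/-! ### Energy of the merging of blocks -/

namespace Plan

variable {pl : Plan} {X : Finset ℕ} {N E l : ℕ} {S : Finset (Fin N)} {c : Fin N → Device}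
  {v : Fin N}

variable (pl) in
/-- The levels below `l` at which device `v` considers itself awake if its roster is `R`. -/
def awakeLevels (l : ℕ) (R : Finset ℕ) (v : ℕ) : Finset ℕ :=
  {j ∈ range l | v ∈ pl.awake j R}

lemma awakeLevels_mono (R : Finset ℕ) (v : ℕ) : Monotone fun l => pl.awakeLevels l R v :=
  fun _ _ hkl => filter_subset_filter _ (range_subset_range.2 hkl)

lemma card_awakeLevels_succ (l : ℕ) (R : Finset ℕ) (v : ℕ) :
    #(pl.awakeLevels (l + 1) R v) =
      #(pl.awakeLevels l R v) + if v ∈ pl.awake l R then 1 else 0 := by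
  unfold awakeLevels
  rw [range_add_one, filter_insert]
  split_ifs
  · exact card_insert_of_notMem (by simp)
  · rfl

lemma Sound.card_awakeLevels_le (hpl : pl.Sound X E) (hl : l ≤ pl.top + 1) (R : Finset ℕ)
    (v : ℕ) : #(pl.awakeLevels l R v) ≤ E :=
  (card_le_card (awakeLevels_mono R v hl)).trans (hpl.card_awake R v)

variable (pl) in
/-- The energy that device `v` may have spent before level `l` if its roster is `R`: at each level
at which it is awake it transmits one report, and before that level it listens to two. -/
def wakeBudget (l : ℕ) (R : Finset ℕ) (v : ℕ) : ℕ :=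
  #(pl.awakeLevels l R v) + 2 * #(pl.awakeLevels (l + 1) R v)

lemma wakeBudget_mono (R : Finset ℕ) (v : ℕ) : Monotone fun l => pl.wakeBudget l R v :=
  fun _ _ hkl => add_le_add (card_le_card (awakeLevels_mono R v hkl)) <|
    Nat.mul_le_mul_left 2 (card_le_card (awakeLevels_mono R v (Nat.succ_le_succ hkl)))

lemma Sound.wakeBudget_top_le (hpl : pl.Sound X E) (R : Finset ℕ) (v : ℕ) :
    pl.wakeBudget pl.top R v ≤ 3 * E :=
  calc pl.wakeBudget pl.top R v ≤ E + 2 * E :=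
        add_le_add (hpl.card_awakeLevels_le (Nat.le_succ _) R v) <|
          Nat.mul_le_mul_left 2 (hpl.card_awakeLevels_le le_rfl R v)
    _ = 3 * E := by ring

lemma spent_levelSlots_le (l : ℕ) (c : Fin N → Device) (v : Fin N) :
    pl.machine.spent S (pl.levelSlots l) c v ≤
      (if (v : ℕ) ∈ pl.awake l (c v).roster then 1 else 0) +
        2 * if (v : ℕ) ∈ pl.awake (l + 1) (c v).roster then 1 else 0 := by
  set R := (c v).roster with hR
  set own : Finset ℕ := if (v : ℕ) ∈ pl.awake l R then {(v : ℕ) / 2 ^ l} else ∅ with own_eq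
  set halves : Finset ℕ := if (v : ℕ) ∈ pl.awake (l + 1) R then
    Ico (2 * ((v : ℕ) / 2 ^ (l + 1))) (2 * ((v : ℕ) / 2 ^ (l + 1)) + 2) else ∅ with halves_eq
  have idle : ∀ u ∈ List.range (2 ^ (pl.top - l)), u ∉ own ∪ halves → ∀ s : Device,
      s.roster = R → pl.machine.act (Slot.report l u) v s = SlotAction.idle := by
    rintro u - hu s hs
    simp only [mem_union, not_or] at hu
    simp only [machine, act, hs]
    rw [if_neg, if_neg]
    · rintro ⟨hparent, hawake⟩
      refine hu.2 ?_
      rw [halves_eq, if_pos hawake, hparent, mem_Ico]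
      omega
    · rintro ⟨rfl, hfirst⟩
      exact hu.1 (by rw [own_eq, if_pos hfirst.1, mem_singleton])
  calc pl.machine.spent S (pl.levelSlots l) c v
      = pl.machine.spent S ((List.range (2 ^ (pl.top - l))).map (Slot.report l)) c v := by
        rw [levelSlots, Machine.spent_append]
        rfl
    _ ≤ #(own ∪ halves) := Machine.spent_map_le_card _ _ List.nodup_range (fun _ _ _ _ hs => hs)
        idle hR.symm
    _ ≤ #own + #halves := card_union_le _ _
    _ = _ := by
      rw [own_eq, halves_eq, apply_ite card, apply_ite card, card_singleton, card_empty,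
        Nat.card_Ico, Nat.add_sub_cancel_left, mul_ite]

lemma wakeBudget_add_spent_le (l : ℕ) (c : Fin N → Device) (v : Fin N) :
    pl.wakeBudget l (c v).roster v + pl.machine.spent S (pl.levelSlots l) c v ≤
      pl.wakeBudget (l + 1) (c v).roster v := by
  have spent_le := spent_levelSlots_le (pl := pl) (S := S) l c v
  unfold wakeBudget
  rw [card_awakeLevels_succ (l + 1), card_awakeLevels_succ l]
  linarith

lemma Informed.wakeBudget_eq (hpl : pl.Sound (ids S) E) (hl : l < pl.top)
    (hc : pl.Informed S l c) (hv : v ∈ S) (halive : (v : ℕ) ∈ pl.alive (ids S) (l + 1)) :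
    pl.wakeBudget (l + 1) (block (l + 1) v (pl.alive (ids S) (l + 1))) v =
      pl.wakeBudget (l + 1) (c v).roster v := by
  have awake_iff : ∀ j ≤ l + 1, (v : ℕ) ∈ pl.awake j (block (l + 1) v (pl.alive (ids S) (l + 1))) ↔
      (v : ℕ) ∈ pl.awake j (c v).roster := fun j hj => by
    rw [hc.mem_awake_iff hpl hv (alive_succ_subset l halive) hj (hj.trans hl)]
    refine mem_team_congr (k := l + 1)
      (fun s hs => (hpl.level_lt (hj.trans hl) hs).le.trans hj) ?_
    rw [block_block le_rfl, block_alive_succ halive]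
  have awakeLevels_eq : ∀ n ≤ l + 2,
      pl.awakeLevels n (block (l + 1) v (pl.alive (ids S) (l + 1))) v =
        pl.awakeLevels n (c v).roster v := fun n hn =>
    filter_congr fun j hj => awake_iff j (Nat.le_of_lt_succ ((mem_range.1 hj).trans_le hn))
  rw [wakeBudget, wakeBudget, awakeLevels_eq _ (Nat.le_succ _), awakeLevels_eq _ le_rfl]

lemma spent_levelSlots_of_roster_eq_empty (hroster : (c v).roster = ∅) :
    pl.machine.spent S (pl.levelSlots l) c v = 0 := by
  have asleep : ∀ j, (v : ℕ) ∉ pl.awake j (c v).roster := fun j hj =>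
    notMem_empty _ (hroster ▸ awake_subset _ _ hj)
  simpa only [if_neg (asleep _), mul_zero, add_zero, Nat.le_zero] using
    spent_levelSlots_le (pl := pl) (S := S) l c v

lemma roster_run_levelSlots_of_roster_eq_empty (hroster : (c v).roster = ∅) :
    (pl.machine.run S (pl.levelSlots l) c v).roster = ∅ := by
  rw [roster_run_levelSlots_of_notMem fun hawake =>
    notMem_empty _ (hroster ▸ awake_subset _ _ hawake), hroster]

lemma spent_slotsBelow_succ (l : ℕ) (v : Fin N) :
    pl.machine.spent S (pl.slotsBelow (l + 1)) pl.machine.start v =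
      pl.machine.spent S (pl.slotsBelow l) pl.machine.start v +
        pl.machine.spent S (pl.levelSlots l) (pl.configAt S l) v :=
  Machine.spent_append _ _ _ _ _ _

/-- A device whose block has been given up spends no more energy, so its budget is that of its last
nonempty roster `R`. -/
lemma spent_slotsBelow_le_wakeBudget (hpl : pl.Sound (ids S) E) (hl : l ≤ pl.top)
    (hN : N ≤ 2 ^ pl.top) (hv : v ∈ S) :
    ∃ R, ((pl.configAt S l v).roster = R ∨ (pl.configAt S l v).roster = ∅) ∧
      pl.machine.spent S (pl.slotsBelow l) pl.machine.start v ≤ pl.wakeBudget l R v := by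
  induction l with
  | zero => exact ⟨_, Or.inl rfl, Nat.zero_le _⟩
  | succ l ih =>
    rw [configAt_succ, spent_slotsBelow_succ]
    obtain ⟨R, rfl | hdead, spent_le⟩ := ih (Nat.le_of_succ_le hl)
    · have hc := informed_configAt hpl (Nat.le_of_succ_le hl) hN
      have budget := (Nat.add_le_add_right spent_le _).trans
        (wakeBudget_add_spent_le (S := S) l (pl.configAt S l) v)
      by_cases hawake : (v : ℕ) ∈ pl.awake (l + 1) (pl.configAt S l v).roster
      · rw [roster_run_levelSlots_of_mem hpl hl hN hc (acc_configAt l v) hv hawake]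
        by_cases halive : (v : ℕ) ∈ pl.alive (ids S) (l + 1)
        · rw [if_pos halive]
          exact ⟨_, Or.inl rfl, budget.trans_eq (hc.wakeBudget_eq hpl hl hv halive).symm⟩
        · rw [if_neg halive]
          exact ⟨_, Or.inr rfl, budget⟩
      · rw [roster_run_levelSlots_of_notMem hawake]
        exact ⟨_, Or.inl rfl, budget⟩
    · refine ⟨R, Or.inr (roster_run_levelSlots_of_roster_eq_empty hdead), ?_⟩
      rw [spent_levelSlots_of_roster_eq_empty hdead, add_zero]
      exact spent_le.trans (wakeBudget_mono R v (Nat.le_succ l))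

lemma spent_slotsBelow_top_le (hpl : pl.Sound (ids S) E) (hN : N ≤ 2 ^ pl.top) (hv : v ∈ S) :
    pl.machine.spent S (pl.slotsBelow pl.top) pl.machine.start v ≤ 3 * E := by
  obtain ⟨R, _, spent_le⟩ := spent_slotsBelow_le_wakeBudget hpl le_rfl hN hv
  exact spent_le.trans (hpl.wakeBudget_top_le R v)

end Plan

/-! ### The final phase -/

namespace Plan

variable {pl : Plan} {N E : ℕ} {S : Finset (Fin N)} {Q : Finset ℕ} {c : Fin N → Device}
  {v : Fin N}

lemma toFinset_sent_subset {d : Slot} {x : ℕ} {s : Device} {m : Message}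
    (hm : (pl.act d x s).sent = some m) : m.toFinset ⊆ insert x (s.roster ∪ s.acc) := by
  cases d <;> simp only [act] at hm <;> (try split_ifs at hm) <;>
    simp only [SlotAction.sent, reduceCtorEq, Option.some.injEq] at hm <;> subst hm
  · rw [sort_toFinset]
    exact subset_union_left.trans (subset_insert _ _)
  · simp_all
  · rw [sort_toFinset]
    exact subset_insert _ _
  · rw [sort_toFinset]
    exact subset_insert _ _

lemma upd_subset (d : Slot) (x : ℕ) (s : Device) (o : Perception) :
    (pl.upd d x s o).roster ∪ (pl.upd d x s o).acc ⊆ s.roster ∪ s.acc ∪ heardIds o := by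
  cases d with
  | commit l =>
    have known_subset : pl.known l x s ⊆ s.roster ∪ s.acc := by
      rw [known, union_comm]
      exact union_subset_union_left (by split_ifs <;> simp)
    refine Subset.trans ?_ subset_union_left
    simp only [upd]
    split_ifs
    · rwa [union_empty]
    · exact empty_subset _
    · exact union_subset_union_right (empty_subset _)
  | _ => exact (union_assoc _ _ _).ge

/-- The devices only know IDs of active devices. -/
def Truthful (S : Finset (Fin N)) (c : Fin N → Device) : Prop :=
  ∀ v ∈ S, (c v).roster ∪ (c v).acc ⊆ ids S

lemma Truthful.heardIds_subset (hc : Truthful S c) (d : Slot) (a : SlotAction) :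
    heardIds (perceive a (channel S (pl.machine.acts d c))) ⊆ ids S := by
  cases hchannel : channel S (pl.machine.acts d c) with
  | none => cases a <;> exact empty_subset _
  | some m =>
    obtain ⟨u, hu, hsent⟩ := exists_sent_of_channel_eq_some hchannel
    cases a with
    | listen =>
      exact (toFinset_sent_subset hsent).trans (insert_subset (val_mem_ids.2 hu) (hc u hu))
    | _ => exact empty_subset _

lemma Truthful.step (hc : Truthful S c) (d : Slot) : Truthful S (pl.machine.step S d c) :=
  fun v hv => (upd_subset _ _ _ _).trans (union_subset (hc v hv) (hc.heardIds_subset d _))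

lemma truthful_run_start (p : List Slot) :
    Truthful S (pl.machine.run S p pl.machine.start) := by
  refine pl.machine.run_induction S (fun d _ c hc => hc.step d) fun v hv => ?_
  exact union_subset (singleton_subset_iff.2 (val_mem_ids.2 hv)) (empty_subset _)

/-- The members of `Q` know `Q`, and the other devices know that they do not belong to `Q`. -/
def Ready (S : Finset (Fin N)) (Q : Finset ℕ) (c : Fin N → Device) : Prop :=
  ∀ v ∈ S, ((v : ℕ) ∈ Q → (c v).roster = Q) ∧ ((v : ℕ) ∉ Q → (v : ℕ) ∉ (c v).roster)

/-- The last roster is shared by all survivors, as there is a single block of level `top`. -/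
lemma ready_configAt_top (hpl : pl.Sound (ids S) E) (hN : N ≤ 2 ^ pl.top) :
    Ready S (pl.alive (ids S) pl.top) (pl.configAt S pl.top) := by
  intro v hv
  have hc := informed_configAt hpl le_rfl hN
  have awake_top : ∀ P, pl.awake pl.top P = P := fun P => by rw [awake, hpl.path_top, team_nil]
  have div_eq_zero : ∀ u : Fin N, (u : ℕ) / 2 ^ pl.top = 0 := fun u =>
    Nat.div_eq_of_lt (u.2.trans_le hN)
  refine ⟨fun halive => ?_, fun hdead => ?_⟩
  · have hawake := (hc.mem_awake_iff hpl hv halive (Nat.le_succ _) le_rfl).2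
      (by rwa [awake_top])
    rw [hc.roster_eq hv hawake]
    refine filter_true_of_mem fun w hw => ?_
    obtain ⟨u, _, rfl⟩ := mem_ids.1 (alive_subset _ hw)
    rw [div_eq_zero, div_eq_zero]
  · simpa only [awake_top] using (hc v hv).2 hdead

namespace Ready

variable (hc : Ready S Q c)
include hc

lemma run {p : List Slot} (hp : ∀ l, Slot.commit l ∉ p) : Ready S Q (pl.machine.run S p c) := by
  intro v hv
  rw [roster_run_of_commit_notMem hp]
  exact hc v hv

lemma mem_roster_iff (hv : v ∈ S) : (v : ℕ) ∈ (c v).roster ↔ (v : ℕ) ∈ Q := by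
  by_cases hvQ : (v : ℕ) ∈ Q
  · rw [(hc v hv).1 hvQ]
  · exact iff_of_false ((hc v hv).2 hvQ) hvQ

lemma rank_eq_iff (hv : v ∈ S) (r : ℕ) :
    ((v : ℕ) ∈ (c v).roster ∧ rank (c v).roster v = r) ↔ ((v : ℕ) ∈ Q ∧ rank Q v = r) := by
  rw [hc.mem_roster_iff hv]
  exact and_congr_right fun hvQ => by rw [(hc v hv).1 hvQ]

lemma isLast_iff (hv : v ∈ S) : IsLast (c v).roster v ↔ IsLast Q v := by
  unfold IsLast
  rw [hc.mem_roster_iff hv]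
  exact and_congr_right fun hvQ => by rw [(hc v hv).1 hvQ]

end Ready

lemma acts_announce (c : Fin N → Device) (v : Fin N) : pl.machine.acts Slot.announce c v =
    if IsLast (c v).roster v then
      SlotAction.transmit (((c v).roster ∪ (c v).acc).sort (· ≤ ·))
    else SlotAction.listen := rfl

lemma mem_step_call (hc : Ready S Q c) (hv : v ∈ S) (hvQ : (v : ℕ) ∈ Q) {x : ℕ}
    (hx : x ∈ ids S) (hrank : x / pl.load = rank Q v) :
    x ∈ Q ∪ (pl.machine.step S (Slot.call x) c v).acc := by
  obtain ⟨u, hu, rfl⟩ := mem_ids.1 hx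
  by_cases hvu : (v : ℕ) = u
  · exact mem_union_left _ (hvu ▸ hvQ)
  have channel_eq : channel S (pl.machine.acts (Slot.call u) c) = some [(u : ℕ)] := by
    refine channel_eq_some hu ?_ fun w _ hwu => ?_ <;> simp only [Machine.acts, machine, act]
    · simp only [if_true, SlotAction.sent]
    · rw [if_neg fun hval => hwu (Fin.ext hval)]
      split_ifs <;> rfl
  have listens : pl.machine.acts (Slot.call u) c v = SlotAction.listen := by
    simp only [Machine.acts, machine, act]
    rw [if_neg hvu, if_pos ((hc.rank_eq_iff hv _).2 ⟨hvQ, hrank.symm⟩)]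
  rw [Machine.step, channel_eq, listens]
  simp [machine, upd, perceive, heardIds]

/-- The slots in which the devices of `U` report their own IDs. -/
def callSlots (U : List ℕ) : List Slot :=
  U.map Slot.call

lemma commit_notMem_callSlots (U : List ℕ) (l : ℕ) : Slot.commit l ∉ callSlots U := by
  simp [callSlots]

lemma mem_run_callSlots (hc : Ready S Q c) (hv : v ∈ S) (hvQ : (v : ℕ) ∈ Q) {U : List ℕ} {x : ℕ}
    (hx : x ∈ ids S) (hxU : x ∈ U) (hrank : x / pl.load = rank Q v) :
    x ∈ Q ∪ (pl.machine.run S (callSlots U) c v).acc := by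
  obtain ⟨before, after, rfl⟩ := List.append_of_mem hxU
  have hready : Ready S Q (pl.machine.run S (callSlots before) c) :=
    hc.run (commit_notMem_callSlots before)
  rw [callSlots, List.map_append, List.map_cons, Machine.run_append, Machine.run_cons]
  exact union_subset_union_right (acc_subset_acc_run (commit_notMem_callSlots after) _ v)
    (mem_step_call hready hv hvQ hx hrank)

lemma acc_subset_step_pass (hc : Ready S Q c) {u : Fin N} {r : ℕ} (hu : u ∈ S)
    (huQ : (u : ℕ) ∈ Q) (hur : rank Q u = r) (hv : v ∈ S) (hvQ : (v : ℕ) ∈ Q)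
    (hvr : rank Q v = r + 1) : (c u).acc ⊆ (pl.machine.step S (Slot.pass r) c v).acc := by
  have channel_eq : channel S (pl.machine.acts (Slot.pass r) c) =
      some (((c u).roster ∪ (c u).acc).sort (· ≤ ·)) := by
    refine channel_eq_some hu ?_ fun w hw hwu => ?_ <;> simp only [Machine.acts, machine, act]
    · rw [if_pos ((hc.rank_eq_iff hu _).2 ⟨huQ, hur⟩), SlotAction.sent]
    · rw [if_neg fun hwr => ?_]
      · split_ifs <;> rfl
      · obtain ⟨hwQ, hwr⟩ := (hc.rank_eq_iff hw _).1 hwr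
        exact hwu (Fin.ext (rank_injOn Q hwQ huQ (hwr.trans hur.symm)))
  have listens : pl.machine.acts (Slot.pass r) c v = SlotAction.listen := by
    simp only [Machine.acts, machine, act]
    rw [if_neg fun hvr' => ?_, if_pos ((hc.rank_eq_iff hv _).2 ⟨hvQ, hvr⟩)]
    have rank_eq := ((hc.rank_eq_iff hv _).1 hvr').2
    omega
  rw [Machine.step, channel_eq, listens]
  simp only [machine, upd, perceive, heardIds, sort_toFinset]
  exact subset_union_right.trans subset_union_right

/-- The slots in which the first `n` devices of the final roster forward their knowledge. -/
def passSlots (n : ℕ) : List Slot :=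
  (List.range n).map Slot.pass

lemma passSlots_succ (n : ℕ) : passSlots (n + 1) = passSlots n ++ [Slot.pass n] := by
  rw [passSlots, passSlots, List.range_succ, List.map_append, List.map_singleton]

lemma commit_notMem_passSlots (n l : ℕ) : Slot.commit l ∉ passSlots n := by
  simp [passSlots]

lemma mem_run_passSlots (hQ : Q ⊆ ids S) (hc : Ready S Q c)
    (called : ∀ v ∈ S, (v : ℕ) ∈ Q → ∀ x ∈ ids S, x / pl.load = rank Q v → x ∈ Q ∪ (c v).acc)
    {n : ℕ} (hv : v ∈ S) (hvQ : (v : ℕ) ∈ Q) (hn : rank Q v ≤ n) {x : ℕ} (hx : x ∈ ids S)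
    (hrank : x / pl.load ≤ rank Q v) :
    x ∈ Q ∪ (pl.machine.run S (passSlots n) c v).acc := by
  induction n generalizing v with
  | zero => exact called v hv hvQ x hx (hrank.antisymm (hn.trans (Nat.zero_le _)))
  | succ n ih =>
    rw [passSlots_succ, Machine.run_concat]
    rcases hn.lt_or_eq with hn | hn
    · exact union_subset_union_right subset_union_left
        (ih hv hvQ (Nat.le_of_lt_succ hn) hrank)
    rcases hrank.eq_or_lt with hrank | hrank
    · exact union_subset_union_right ((acc_subset_acc_run (commit_notMem_passSlots n) c v).trans
        subset_union_left) (called v hv hvQ x hx hrank)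
    obtain ⟨y, hy, hyn⟩ := exists_rank_eq (P := Q) (r := n) (by have := rank_lt_card hvQ; omega)
    obtain ⟨u, hu, rfl⟩ := mem_ids.1 (hQ hy)
    exact union_subset_union_right
      (acc_subset_step_pass (hc.run (commit_notMem_passSlots n)) hu hy hyn hv hvQ hn)
      (ih hu hy hyn.le (by omega))

variable (pl) in
/-- All slots but the last one. -/
def mainSlots : List Slot :=
  pl.slotsBelow pl.top ++ (callSlots (List.range (2 ^ pl.top)) ++ passSlots (2 ^ pl.top))

variable (pl) in
/-- All slots. -/
def slots : List Slot :=
  pl.mainSlots ++ [Slot.announce]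

lemma run_mainSlots : pl.machine.run S pl.mainSlots pl.machine.start =
    pl.machine.run S (passSlots (2 ^ pl.top))
      (pl.machine.run S (callSlots (List.range (2 ^ pl.top))) (pl.configAt S pl.top)) := by
  rw [mainSlots, Machine.run_append, Machine.run_append, configAt]

lemma ready_run_mainSlots (hpl : pl.Sound (ids S) E) (hN : N ≤ 2 ^ pl.top) :
    Ready S (pl.alive (ids S) pl.top) (pl.machine.run S pl.mainSlots pl.machine.start) := by
  rw [run_mainSlots]
  exact ((ready_configAt_top hpl hN).run (commit_notMem_callSlots _)).run
    (commit_notMem_passSlots _)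

lemma roster_union_acc_run_mainSlots (hpl : pl.Sound (ids S) E) (hN : N ≤ 2 ^ pl.top)
    (hload : 2 ^ pl.top ≤ pl.load * #(pl.alive (ids S) pl.top)) (hv : v ∈ S)
    (hlast : IsLast (pl.alive (ids S) pl.top) v) :
    (pl.machine.run S pl.mainSlots pl.machine.start v).roster ∪
      (pl.machine.run S pl.mainSlots pl.machine.start v).acc = ids S := by
  obtain ⟨hvQ, hrank⟩ := hlast
  refine Subset.antisymm (truthful_run_start _ v hv) fun x hx => ?_
  have hlt : ∀ y ∈ ids S, y < 2 ^ pl.top := fun y hy => by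
    obtain ⟨u, _, rfl⟩ := mem_ids.1 hy
    exact u.2.trans_le hN
  have card_le : #(pl.alive (ids S) pl.top) ≤ 2 ^ pl.top := by
    simpa using card_le_card fun y hy => mem_range.2 (hlt y (alive_subset _ hy))
  have div_lt : x / pl.load < #(pl.alive (ids S) pl.top) :=
    Nat.div_lt_of_lt_mul ((hlt x hx).trans_le hload)
  have hready := ready_configAt_top hpl hN
  rw [(ready_run_mainSlots hpl hN v hv).1 hvQ, run_mainSlots]
  exact mem_run_passSlots (alive_subset _) (hready.run (commit_notMem_callSlots _))
    (fun w hw hwQ y hy => mem_run_callSlots hready hw hwQ hy (List.mem_range.2 (hlt y hy)))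
    hv hvQ (by omega) hx (by omega)

lemma spent_callSlots_le (hload : 0 < pl.load) (n : ℕ) (c : Fin N → Device) (v : Fin N) :
    pl.machine.spent S (callSlots (List.range n)) c v ≤ pl.load + 1 := by
  set r := rank (c v).roster v with hr
  have idle : ∀ x ∈ List.range n, x ∉ insert (v : ℕ) (Ico (r * pl.load) (r * pl.load + pl.load)) →
      ∀ s : Device, rank s.roster v = r →
        pl.machine.act (Slot.call x) v s = SlotAction.idle := by
    rintro x - hx s hs
    simp only [mem_insert, mem_Ico, not_or] at hx
    simp only [machine, act, hs]
    rw [if_neg (Ne.symm hx.1), if_neg]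
    rintro ⟨-, hdiv⟩
    exact hx.2 (hdiv ▸ ⟨Nat.div_mul_le_self x _, Nat.lt_div_mul_add hload⟩)
  calc pl.machine.spent S (callSlots (List.range n)) c v
      ≤ #(insert (v : ℕ) (Ico (r * pl.load) (r * pl.load + pl.load))) :=
        Machine.spent_map_le_card _ _ List.nodup_range (fun _ _ _ _ hs => hs) idle hr.symm
    _ ≤ #(Ico (r * pl.load) (r * pl.load + pl.load)) + 1 := card_insert_le _ _
    _ = pl.load + 1 := by rw [Nat.card_Ico, Nat.add_sub_cancel_left]

lemma spent_passSlots_le (n : ℕ) (c : Fin N → Device) (v : Fin N) :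
    pl.machine.spent S (passSlots n) c v ≤ 2 := by
  set r := rank (c v).roster v with hr
  have idle : ∀ q ∈ List.range n, q ∉ ({r, r - 1} : Finset ℕ) → ∀ s : Device,
      rank s.roster v = r → pl.machine.act (Slot.pass q) v s = SlotAction.idle := by
    rintro q - hq s hs
    simp only [mem_insert, mem_singleton, not_or] at hq
    simp only [machine, act, hs]
    rw [if_neg fun hrank => hq.1 hrank.2.symm, if_neg fun hrank => hq.2 (by omega)]
  exact (Machine.spent_map_le_card _ _ List.nodup_range (fun _ _ _ _ hs => hs) idle
    hr.symm).trans card_le_two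

lemma spent_slots_le (hpl : pl.Sound (ids S) E) (hN : N ≤ 2 ^ pl.top) (hload : 0 < pl.load)
    (hv : v ∈ S) : pl.machine.spent S pl.slots pl.machine.start v ≤ 3 * E + pl.load + 4 := by
  rw [slots, mainSlots, Machine.spent_append, Machine.spent_append, Machine.spent_append,
    Machine.spent_singleton]
  have merging := spent_slotsBelow_top_le hpl hN hv
  have calling := spent_callSlots_le (S := S) hload (2 ^ pl.top) (pl.configAt S pl.top) v
  have passing := spent_passSlots_le (pl := pl) (S := S) (2 ^ pl.top)
    (pl.machine.run S (callSlots (List.range (2 ^ pl.top))) (pl.configAt S pl.top)) v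
  rw [configAt] at calling passing
  exact (add_le_add (add_le_add merging (add_le_add calling passing))
    (SlotAction.cost_le_one _)).trans_eq (by ring)

lemma length_levelSlots (l : ℕ) : (pl.levelSlots l).length = 2 ^ (pl.top - l) + 1 := by
  simp [levelSlots]

lemma length_slotsBelow {l : ℕ} (hl : l ≤ pl.top) :
    (pl.slotsBelow l).length + 2 * 2 ^ (pl.top - l) = 2 * 2 ^ pl.top + l := by
  induction l with
  | zero => simp [slotsBelow]
  | succ l ih =>
    have two_pow_eq : 2 ^ (pl.top - l) = 2 * 2 ^ (pl.top - (l + 1)) := by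
      rw [← pow_succ', show pl.top - l = pl.top - (l + 1) + 1 by omega]
    have length_eq := ih (Nat.le_of_succ_le hl)
    rw [slotsBelow, List.length_append, length_levelSlots]
    omega

lemma length_slots_le : pl.slots.length ≤ 5 * 2 ^ pl.top := by
  have length_eq := length_slotsBelow (pl := pl) le_rfl
  have top_lt := Nat.lt_two_pow_self (n := pl.top)
  rw [Nat.sub_self, pow_zero] at length_eq
  simp only [slots, mainSlots, callSlots, passSlots, List.length_append, List.length_map,
    List.length_range, List.length_singleton]
  omega

/-- The algorithm that follows a plan for each size of the ID space. -/
def algorithm (pl : ℕ → Plan) : Algorithm :=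
  Machine.toAlgorithm (fun N => (pl N).machine) fun N => (pl N).slots

section Algorithm

variable {pl : ℕ → Plan}

lemma time_algorithm : (algorithm pl).time N = (pl N).mainSlots.length + 1 :=
  List.length_append

lemma time_algorithm_le : (algorithm pl).time N ≤ 5 * 2 ^ (pl N).top :=
  length_slots_le

lemma energy_algorithm_le (hpl : (pl N).Sound (ids S) E) (hN : N ≤ 2 ^ (pl N).top)
    (hload : 0 < (pl N).load) (hv : v ∈ S) :
    (algorithm pl).energy S v ≤ 3 * E + (pl N).load + 4 :=
  (Machine.energy_eq S _ _ v).trans_le (spent_slots_le hpl hN hload hv)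

lemma finalRole_algorithm (hpl : (pl N).Sound (ids S) E) (hN : N ≤ 2 ^ (pl N).top)
    (hv : v ∈ S) : (algorithm pl).finalRole S v =
      if IsLast ((pl N).alive (ids S) (pl N).top) v then Role.leader else Role.follower := by
  have hready : Ready S ((pl N).alive (ids S) (pl N).top)
      ((pl N).machine.run S (pl N).slots (pl N).machine.start) := by
    rw [slots, Machine.run_append]
    exact (ready_run_mainSlots hpl hN).run (by simp)
  rw [algorithm, Machine.finalRole_eq]
  simp only [machine, ← hready.isLast_iff hv]

lemma announces_algorithm (hpl : (pl N).Sound (ids S) E) (hN : N ≤ 2 ^ (pl N).top)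
    (hload : 2 ^ (pl N).top ≤ (pl N).load * #((pl N).alive (ids S) (pl N).top)) (hv : v ∈ S)
    (hlast : IsLast ((pl N).alive (ids S) (pl N).top) v) :
    (algorithm pl).Announces S (pl N).mainSlots.length v ((ids S).sort (· ≤ ·)) := by
  have hready := ready_run_mainSlots hpl hN
  have action_last : ∀ w, (algorithm pl).action S (pl N).mainSlots.length w =
      (pl N).machine.acts Slot.announce
        ((pl N).machine.run S (pl N).mainSlots (pl N).machine.start) w :=
    Machine.action_last S _ _ rfl
  refine ⟨?_, fun w hw hwv => ?_⟩ <;> rw [action_last, acts_announce]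
  · rw [if_pos ((hready.isLast_iff hv).2 hlast),
      roster_union_acc_run_mainSlots hpl hN hload hv hlast]
  · rw [if_neg fun hlast_w => hwv (Fin.ext (((hready.isLast_iff hw).1 hlast_w).eq hlast))]

lemma exists_isLast_alive_top
    (hload : 2 ^ (pl N).top ≤ (pl N).load * #((pl N).alive (ids S) (pl N).top)) :
    ∃ v ∈ S, IsLast ((pl N).alive (ids S) (pl N).top) v := by
  have card_pos : 0 < #((pl N).alive (ids S) (pl N).top) :=
    Nat.pos_of_mul_pos_left (Nat.two_pow_pos _ |>.trans_le hload)
  obtain ⟨x, hx⟩ := exists_isLast (Finset.card_pos.1 card_pos)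
  obtain ⟨v, hv, rfl⟩ := mem_ids.1 (alive_subset _ hx.1)
  exact ⟨v, hv, hx⟩

lemma solvesLeaderElection_algorithm (hpl : (pl N).Sound (ids S) E) (hN : N ≤ 2 ^ (pl N).top)
    (hload : 2 ^ (pl N).top ≤ (pl N).load * #((pl N).alive (ids S) (pl N).top)) :
    (algorithm pl).SolvesLeaderElection S := by
  obtain ⟨v, hv, hlast⟩ := exists_isLast_alive_top hload
  refine ⟨v, hv, ?_, fun w hw hwv => ?_, _, _, time_algorithm,
    announces_algorithm hpl hN hload hv hlast⟩
  · rw [finalRole_algorithm hpl hN hv, if_pos hlast]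
  · rw [finalRole_algorithm hpl hN hw, if_neg fun hlast_w => hwv (Fin.ext (hlast_w.eq hlast))]

lemma solvesCensus_algorithm (hpl : (pl N).Sound (ids S) E) (hN : N ≤ 2 ^ (pl N).top)
    (hload : 2 ^ (pl N).top ≤ (pl N).load * #((pl N).alive (ids S) (pl N).top)) :
    (algorithm pl).SolvesCensus S := by
  obtain ⟨v, hv, hlast⟩ := exists_isLast_alive_top hload
  exact ⟨v, hv, _, _, time_algorithm, announces_algorithm hpl hN hload hv hlast,
    sort_nodup _ _, fun x => by rw [mem_sort, mem_ids]⟩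

end Algorithm

end Plan

/-! ### The choice of the parameters -/

lemma le_ack_inverseAck (N : ℕ) : N ≤ ack (inverseAck N) (inverseAck N) :=
  Nat.find_spec (p := fun i => N ≤ ack i i) ⟨N, (lt_ack_left N N).le⟩

lemma one_le_inverseAck {N : ℕ} (hN : 2 ≤ N) : 1 ≤ inverseAck N := by
  refine Nat.one_le_iff_ne_zero.2 fun hzero => ?_
  have hle := le_ack_inverseAck N
  rw [hzero, ack_zero] at hle
  omega

lemma ack_self_le (i : ℕ) : ack i i ≤ ack (i + 1) 1 := by
  rw [ack_succ_eq_iterate]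
  exact ack_le_ack le_rfl (lt_ack_left i 1).le

lemma le_finish {b : ℕ} (N : ℕ) (hb : 8 ≤ b) : N ≤ finish (inverseAck N + 1) b 0 := by
  have he : 4 ≤ teamExp b 0 := by rw [teamExp]; omega
  calc N ≤ ack (inverseAck N) (inverseAck N) := le_ack_inverseAck N
    _ ≤ ack (inverseAck N + 1) 1 := ack_self_le _
    _ ≤ ack (inverseAck N + 1) (teamExp b 0) := ack_le_ack le_rfl (by omega)
    _ ≤ teamExp (finish (inverseAck N + 1) b 0) 0 := ack_le_teamExp_finish _ he
    _ ≤ finish (inverseAck N + 1) b 0 := (Nat.sub_le _ _).trans (Nat.div_le_self _ _)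

lemma lt_finish_of_lt_clog {b l N : ℕ} (hb : 8 ≤ b) (hl : l < Nat.clog 2 N) :
    l < finish (inverseAck N + 1) b 0 :=
  hl.trans_le ((Nat.clog_le_of_le_pow Nat.lt_two_pow_self.le).trans (le_finish N hb))

lemma two_pow_clog_le {N : ℕ} (hN : 2 ≤ N) : 2 ^ Nat.clog 2 N ≤ 2 * N := by
  obtain ⟨d, hd⟩ := Nat.exists_eq_succ_of_ne_zero (Nat.clog_pos Nat.one_lt_two hN).ne'
  have hlt := Nat.pow_pred_clog_lt_self Nat.one_lt_two hN
  rw [hd, Nat.pred_succ] at hlt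
  rw [hd, pow_succ']
  omega

/-- The plan for the ID space `{0, …, N - 1}`: below level `b` and at the top every device is
awake. In between, the blocks are thinned out so that level `l` keeps at least `2 ^ (l / 2)`
devices per block, and a route of depth `inverseAck N + 1`, which is long enough to reach the top,
selects the teams. -/
def plan (b w N : ℕ) : Plan where
  path l := if b ≤ l ∧ l < Nat.clog 2 N then route (inverseAck N + 1) b 0 l else []
  thr l := if b ≤ l then 2 ^ (l / 2) else 0
  top := Nat.clog 2 N
  load := w

section Plan

variable {b w N l : ℕ} {X : Finset ℕ}

lemma path_plan (hbl : b ≤ l) (hl : l < Nat.clog 2 N) :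
    (plan b w N).path l = route (inverseAck N + 1) b 0 l :=
  if_pos ⟨hbl, hl⟩

lemma path_plan_eq_nil (hl : ¬(b ≤ l ∧ l < Nat.clog 2 N)) : (plan b w N).path l = [] :=
  if_neg hl

lemma thr_plan (hbl : b ≤ l) : (plan b w N).thr l = 2 ^ (l / 2) :=
  if_pos hbl

lemma thr_plan_of_lt (hlb : l < b) : (plan b w N).thr l = 0 :=
  if_neg hlb.not_ge

lemma le_and_lt_of_mem_path_plan {s : Split} (hs : s ∈ (plan b w N).path l) :
    b ≤ l ∧ l < Nat.clog 2 N := by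
  by_contra hl
  simp [path_plan_eq_nil hl] at hs

lemma thick_alive_plan (hb : 0 < b) : Thick b l ((plan b w N).alive X l) := by
  intro k hbk hkl v hv
  have thr_le := Plan.thr_le_card_block (hb.trans_le hbk) hkl hv
  rwa [thr_plan hbk] at thr_le

lemma path_plan_consistent (hb : 8 ≤ b) {p p' : List Split} {s : Split}
    (hpath : (plan b w N).path l = p ++ s :: p') :
    s.level < l ∧ (plan b w N).path s.level = p := by
  obtain ⟨hbl, hl⟩ := le_and_lt_of_mem_path_plan (hpath ▸ List.mem_append_cons_self)
  rw [path_plan hbl hl] at hpath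
  obtain ⟨hbs, hsl, hroute⟩ := route_consistent _ hbl (lt_finish_of_lt_clog hb hl) hpath
  exact ⟨hsl, by rw [path_plan hbs (hsl.trans hl), hroute]⟩

lemma exists_awake_plan (hb : 8 ≤ b) {v : ℕ} (hv : v ∈ (plan b w N).alive X l) :
    ∃ u ∈ (plan b w N).awake l ((plan b w N).alive X l), u / 2 ^ l = v / 2 ^ l := by
  rw [Plan.awake]
  by_cases hl : b ≤ l ∧ l < Nat.clog 2 N
  · rw [path_plan hl.1 hl.2]
    exact (thick_alive_plan (by omega)).exists_awake _ (fun u _ => by simp) le_rfl hl.1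
      (lt_finish_of_lt_clog hb hl.2) le_rfl hv
  · exact ⟨v, by rwa [path_plan_eq_nil hl, team_nil], rfl⟩

lemma card_awake_plan_le (hb : 8 ≤ b) (P : Finset ℕ) (v : ℕ) :
    #{l ∈ range (Nat.clog 2 N + 1) | v ∈ (plan b w N).awake l P} ≤
      b + (3 * (inverseAck N + 1) + 2) + 1 := by
  set R := {l ∈ Ico b (finish (inverseAck N + 1) b 0) |
    v ∈ team (route (inverseAck N + 1) b 0 l) P}
  have hsub : {l ∈ range (Nat.clog 2 N + 1) | v ∈ (plan b w N).awake l P} ⊆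
      (range b ∪ R) ∪ {Nat.clog 2 N} := by
    intro l hl
    obtain ⟨hl_top, hawake⟩ := mem_filter.1 hl
    simp only [mem_union, mem_range, mem_singleton]
    rcases lt_or_ge l b with hlb | hbl
    · exact Or.inl (Or.inl hlb)
    rcases (Nat.le_of_lt_succ (mem_range.1 hl_top)).eq_or_lt with htop | hlt
    · exact Or.inr htop
    rw [Plan.awake, path_plan hbl hlt] at hawake
    exact Or.inl (Or.inr (mem_filter.2 ⟨mem_Ico.2 ⟨hbl, lt_finish_of_lt_clog hb hlt⟩, hawake⟩))
  calc _ ≤ #((range b ∪ R) ∪ {Nat.clog 2 N}) := card_le_card hsub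
    _ ≤ #(range b ∪ R) + 1 := card_union_le _ _
    _ ≤ #(range b) + #R + 1 := by gcongr; exact card_union_le _ _
    _ ≤ b + (3 * (inverseAck N + 1) + 2) + 1 := by
      rw [card_range]
      gcongr
      exact card_route_le _ _ _ _ _

lemma sound_plan (hb : 8 ≤ b) :
    (plan b w N).Sound X (b + (3 * (inverseAck N + 1) + 2) + 1) where
  consistent _ _ _ _ _ hpath := path_plan_consistent hb hpath
  path_top := path_plan_eq_nil fun hl => lt_irrefl _ hl.2
  exists_awake _ _ _ hv := exists_awake_plan hb hv
  card_awake P v := card_awake_plan_le hb P v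

end Plan

/-! ### The number of survivors -/

namespace Plan

variable {pl : Plan} {X : Finset ℕ}

lemma card_alive_le (hX : ∀ x ∈ X, x < 2 ^ pl.top) {l : ℕ} (hl : l + 1 ≤ pl.top) :
    #(pl.alive X l) ≤ #(pl.alive X (l + 1)) + pl.thr (l + 1) * 2 ^ (pl.top - (l + 1)) := by
  set lost := {v ∈ pl.alive X l | ¬pl.thr (l + 1) ≤ #(block (l + 1) v (pl.alive X l))}
  have blocks : ∀ v ∈ lost, v / 2 ^ (l + 1) ∈ range (2 ^ (pl.top - (l + 1))) := by
    intro v hv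
    refine mem_range.2 (Nat.div_lt_of_lt_mul ?_)
    rw [← pow_add, Nat.add_sub_cancel' hl]
    exact hX v (alive_subset _ (mem_filter.1 hv).1)
  have card_lost_block : ∀ u ∈ range (2 ^ (pl.top - (l + 1))),
      #{v ∈ lost | v / 2 ^ (l + 1) = u} ≤ pl.thr (l + 1) := by
    intro u _
    rcases eq_empty_or_nonempty {v ∈ lost | v / 2 ^ (l + 1) = u} with hempty | ⟨v, hv⟩
    · simp [hempty]
    · obtain ⟨hv_lost, rfl⟩ := mem_filter.1 hv
      refine le_trans (card_le_card fun w hw => ?_) (not_le.1 (mem_filter.1 hv_lost).2).le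
      exact mem_block.2 ⟨(mem_filter.1 (mem_filter.1 hw).1).1, (mem_filter.1 hw).2⟩
  have card_lost := card_le_mul_card_image_of_maps_to blocks _ card_lost_block
  rw [card_range] at card_lost
  calc #(pl.alive X l) = #(pl.alive X (l + 1)) + #lost :=
        (card_filter_add_card_filter_not _).symm
    _ ≤ _ := Nat.add_le_add_left card_lost _

lemma card_le_card_alive_add_sum (hX : ∀ x ∈ X, x < 2 ^ pl.top) {n : ℕ} (hn : n ≤ pl.top) :
    #X ≤ #(pl.alive X n) + ∑ l ∈ Ioc 0 n, pl.thr l * 2 ^ (pl.top - l) := by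
  induction n with
  | zero => simp [alive]
  | succ n ih =>
    rw [sum_Ioc_succ_top n.zero_le]
    have card_le := ih (Nat.le_of_succ_le hn)
    have card_succ_le := card_alive_le hX hn
    omega

end Plan

lemma sum_Ico_one_div_two_pow (β n : ℕ) :
    ∑ l ∈ Ico (2 * β) (2 * (β + n)), (1 : ℝ) / 2 ^ ((l + 1) / 2) = 3 / 2 ^ β - 3 / 2 ^ (β + n) := by
  induction n with
  | zero => simp
  | succ n ih =>
    rw [show 2 * (β + (n + 1)) = 2 * (β + n) + 1 + 1 by ring, sum_Ico_succ_top (by omega),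
      sum_Ico_succ_top (by omega), ih, show (2 * (β + n) + 1) / 2 = β + n by omega,
      show (2 * (β + n) + 1 + 1) / 2 = β + n + 1 by omega, ← add_assoc, pow_succ]
    ring

lemma sum_Ico_one_div_two_pow_le (β n : ℕ) :
    ∑ l ∈ Ico (2 * β) n, (1 : ℝ) / 2 ^ ((l + 1) / 2) ≤ 3 / 2 ^ β :=
  calc ∑ l ∈ Ico (2 * β) n, (1 : ℝ) / 2 ^ ((l + 1) / 2)
      ≤ ∑ l ∈ Ico (2 * β) (2 * (β + n)), (1 : ℝ) / 2 ^ ((l + 1) / 2) :=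
        sum_le_sum_of_subset_of_nonneg (Ico_subset_Ico_right (by omega)) fun _ _ _ => by positivity
    _ = 3 / 2 ^ β - 3 / 2 ^ (β + n) := sum_Ico_one_div_two_pow β n
    _ ≤ 3 / 2 ^ β := sub_le_self _ (by positivity)

section Survivors

variable {β w N : ℕ}

lemma sum_thr_plan_le (hβ : 0 < β) :
    ∑ l ∈ Ioc 0 (Nat.clog 2 N), ((plan (2 * β) w N).thr l : ℝ) * 2 ^ (Nat.clog 2 N - l) ≤
      2 ^ Nat.clog 2 N * (3 / 2 ^ β) := by
  set g := Nat.clog 2 N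
  have hsub : Ico (2 * β) (g + 1) ⊆ Ioc 0 g := fun l hl => by
    rw [mem_Ico] at hl
    exact mem_Ioc.2 ⟨by omega, by omega⟩
  have thr_eq_zero : ∀ l ∈ Ioc 0 g, l ∉ Ico (2 * β) (g + 1) →
      ((plan (2 * β) w N).thr l : ℝ) * 2 ^ (g - l) = 0 := fun l hl hl' => by
    rw [mem_Ioc] at hl
    rw [mem_Ico] at hl'
    rw [thr_plan_of_lt (by omega), Nat.cast_zero, zero_mul]
  rw [← sum_subset hsub thr_eq_zero]
  refine le_trans (le_of_eq ?_)
    (mul_le_mul_of_nonneg_left (sum_Ico_one_div_two_pow_le β (g + 1)) (by positivity))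
  rw [mul_sum]
  refine sum_congr rfl fun l hl => ?_
  rw [mem_Ico] at hl
  rw [thr_plan hl.1, mul_one_div, eq_div_iff (by positivity), Nat.cast_pow, Nat.cast_ofNat,
    ← pow_add, ← pow_add]
  congr 1
  omega

lemma le_card_alive_plan {c : ℝ} (hc : 0 < c) (hβ : 0 < β) (hβc : 12 / c ≤ 2 ^ β) (hN : 2 ≤ N)
    {X : Finset ℕ} (hX : ∀ x ∈ X, x < N) (hcard : c * N ≤ #X) :
    c * N / 2 ≤ #((plan (2 * β) w N).alive X (Nat.clog 2 N)) := by
  have hX_top : ∀ x ∈ X, x < 2 ^ (plan (2 * β) w N).top := fun x hx =>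
    (hX x hx).trans_le (Nat.le_pow_clog Nat.one_lt_two N)
  have card_le : (#X : ℝ) ≤ #((plan (2 * β) w N).alive X (Nat.clog 2 N)) +
      ∑ l ∈ Ioc 0 (Nat.clog 2 N), ((plan (2 * β) w N).thr l : ℝ) * 2 ^ (Nat.clog 2 N - l) := by
    exact_mod_cast Plan.card_le_card_alive_add_sum hX_top le_rfl
  have top_le : (2 : ℝ) ^ Nat.clog 2 N ≤ 2 * N := by exact_mod_cast two_pow_clog_le hN
  have lost_le : (2 : ℝ) ^ Nat.clog 2 N * (3 / 2 ^ β) ≤ c * N / 2 :=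
    calc (2 : ℝ) ^ Nat.clog 2 N * (3 / 2 ^ β) ≤ 2 * N * (3 / (12 / c)) := by gcongr
      _ = c * N / 2 := by field_simp; norm_num
  have sum_le := sum_thr_plan_le (w := w) (N := N) hβ
  linarith

lemma two_pow_top_plan_le {c : ℝ} (hc : 0 < c) (hβ : 0 < β) (hβc : 12 / c ≤ 2 ^ β)
    (hwc : 4 / c ≤ w) (hN : 2 ≤ N) {X : Finset ℕ} (hX : ∀ x ∈ X, x < N) (hcard : c * N ≤ #X) :
    2 ^ Nat.clog 2 N ≤ w * #((plan (2 * β) w N).alive X (Nat.clog 2 N)) := by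
  refine (two_pow_clog_le hN).trans ?_
  have two_mul_le : (2 * N : ℝ) ≤ w * #((plan (2 * β) w N).alive X (Nat.clog 2 N)) :=
    calc (2 * N : ℝ) = 4 / c * (c * N / 2) := by field_simp; norm_num
      _ ≤ w * #((plan (2 * β) w N).alive X (Nat.clog 2 N)) := by
        gcongr
        exact le_card_alive_plan hc hβ hβc hN hX hcard
  exact_mod_cast two_mul_le

end Survivors

lemma lt_of_mem_ids {N : ℕ} {S : Finset (Fin N)} {x : ℕ} (hx : x ∈ ids S) : x < N := by
  obtain ⟨v, _, rfl⟩ := mem_ids.1 hx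
  exact v.2

end NoCD

theorem mainTheorem5_general :
    (∀ c : ℝ, 0 < c → ∃ A : NoCD.Algorithm, ∃ C : ℕ,
      ∀ (N : ℕ) (S : Finset (Fin N)), 2 ≤ N → c * (N : ℝ) ≤ (S.card : ℝ) →
        A.SolvesLeaderElection S ∧ A.SolvesCensus S ∧
        (∀ v ∈ S, A.energy S v ≤ C * NoCD.inverseAck N) ∧
        A.time N ≤ C * N) ∧
    (∀ i j : ℕ, 1 < j → ack i j ≤ NoCD.growthA i j ∧ ack i j ≤ NoCD.growthB i j) := by
  refine ⟨fun c hc => ?_, fun i j hj => ⟨NoCD.ack_le_growthA i hj, NoCD.ack_le_growthB i hj⟩⟩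
  obtain ⟨β, hβ_ge, hβ⟩ : ∃ β, 4 ≤ β ∧ 12 / c ≤ 2 ^ β := ((Filter.eventually_ge_atTop 4).and
    ((tendsto_pow_atTop_atTop_of_one_lt one_lt_two).eventually_ge_atTop (12 / c))).exists
  obtain ⟨w, hw⟩ := exists_nat_gt (4 / c)
  have hw_pos : 0 < w := Nat.cast_pos.1 ((by positivity : 0 < 4 / c).trans hw)
  let pl := NoCD.plan (2 * β) w
  refine ⟨NoCD.Plan.algorithm pl, 6 * β + w + 31, fun N S hN hS => ?_⟩
  have hsound := NoCD.sound_plan (w := w) (N := N) (X := NoCD.ids S) (by omega : 8 ≤ 2 * β)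
  have hN_top : N ≤ 2 ^ (pl N).top := Nat.le_pow_clog Nat.one_lt_two N
  have hload : 2 ^ (pl N).top ≤ w * #((pl N).alive (NoCD.ids S) (pl N).top) :=
    NoCD.two_pow_top_plan_le hc (by omega) hβ hw.le hN (fun x => NoCD.lt_of_mem_ids)
      (by rwa [NoCD.ids, card_map])
  refine ⟨NoCD.Plan.solvesLeaderElection_algorithm hsound hN_top hload,
    NoCD.Plan.solvesCensus_algorithm hsound hN_top hload, fun v hv => ?_, ?_⟩
  · have hα := NoCD.one_le_inverseAck hN
    calc (NoCD.Plan.algorithm pl).energy S v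
        ≤ 3 * (2 * β + (3 * (NoCD.inverseAck N + 1) + 2) + 1) + w + 4 :=
          NoCD.Plan.energy_algorithm_le hsound hN_top hw_pos hv
      _ ≤ (6 * β + w + 31) * NoCD.inverseAck N := by nlinarith
  · calc (NoCD.Plan.algorithm pl).time N ≤ 5 * 2 ^ (pl N).top := NoCD.Plan.time_algorithm_le
      _ ≤ 5 * (2 * N) := Nat.mul_le_mul_left 5 (NoCD.two_pow_clog_le hN)
      _ ≤ (6 * β + w + 31) * N := by nlinarith

theorem mainTheorem5 :
    (∀ c : ℝ, 0 < c → ∃ A : NoCD.Algorithm, ∃ C : ℕ,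
      ∀ (N : ℕ) (S : Finset (Fin N)), 2 ≤ S.card → c * (N : ℝ) ≤ (S.card : ℝ) →
        A.SolvesLeaderElection S ∧ A.SolvesCensus S ∧
        (∀ v ∈ S, A.energy S v ≤ C * NoCD.inverseAck N) ∧
        A.time N ≤ C * N) ∧
    (∀ i j : ℕ, 32 < j → ack i j ≤ NoCD.growthA i j ∧ ack i j ≤ NoCD.growthB i j) := by
  refine ⟨fun c hc => ?_, fun i j hj => mainTheorem5_general.2 i j (by omega)⟩
  obtain ⟨A, C, hA⟩ := mainTheorem5_general.1 c hc
  exact ⟨A, C, fun N S hS =>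
    hA N S (hS.trans ((card_le_univ S).trans_eq (Fintype.card_fin N)))⟩
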